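/- Let $\mathcal X$ be a finite alphabet with $|\mathcal X|\ge 2$. The Ising channel over $\mathcal X$ has, at each time $t$, input $X_t$, state $S_{t-1}$ and output $Y_t$, where $Y_t=X_t$ or $Y_t=S_{t-1}$, each with probability $1/2$ (independently over time), and $S_t=X_t$; the initial state $S_0$ is arbitrary. With feedback, $X_t$ is a function of the message and of $Y_1,\dots,Y_{t-1}$. Logarithms are to base 2 and $H_2(p)=-p\log p-(1-p)\log(1-p)$. Consider the following scheme for sending a stream $\nu_1,\dots,\nu_K\in\mathcal X$ ($K\ge1$). Encoder: send $\nu_1$ twice. For $i\ge 2$, if $\nu_i=\nu_{i-1}$ send $\nu_i$ twice; if $\nu_i\ne\nu_{i-1}$ send $\nu_i$ once, and send it a second time if and only if the output just received differs from $\nu_i$. Decoder: $\hat\nu_1$ is the second output; for $i\ge2$, if the next output differs from $\hat\nu_{i-1}$ it is $\hat\nu_i$, and otherwise $\hat\nu_i$ is the output following it. The transmission stops when $K$ symbols have been decoded. 1. (Zero error.) For every stream, every initial state and every behaviour of the channel, the scheme stops after at most $2K$ channel uses and $\hat\nu_i=\nu_i$ for all $i\le K$. 2. (Markov streams.) Let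 $p\in[0,1]$, let $\nu_1$ be uniform, and let $\nu_i=\nu_{i-1}$ with probability $p$ and $\nu_i$ be uniform on $\mathcal X\setminus\{\nu_{i-1}\}$ with probability $1-p$. Then $H(\nu_1,\dots,\nu_K)=\log|\mathcal X|+(K-1)\,h(p)$ with $h(p)=H_2(p)+(1-p)\log(|\mathcal X|-1)$, and the expected number of channel uses is $2+(K-1)\,\ell(p)$ with $\ell(p)=2p+1.5(1-p)$, for every initial state. 3. (Rate.) Let $p\in(0,1)$. Then $h(p)/\ell(p)=R_p:=\dfrac{2\left(H_2(p)+(1-p)\log(|\mathcal X|-1)\right)}{p+3}$, and there are lengths $K_n\ge1$ and injective maps $\varphi_n:\{0,1\}^n\to\mathcal X^{K_n}$ such that, for a message of $n$ uniform bits, (a) the law of the stream $\varphi_n(\text{message})$ has relative entropy $o(K_n)$ with respect to the Markov law of part 2; (b) applying the scheme to this stream gives a zero-error feedback code that stops after at most $2K_n$ channel uses; (c) as $n\to\infty$, for every initial state, the expected number $T_n$ of channel uses satisfies $n/K_n\to h(p)$, $T_n/K_n\to\ell(p)$ and $n/T_n\to R_p$. 4. (Maximum.) The maximum $R(\mathcal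 X)=\max_{p\in[0,1]}R_p$ exists and is attained at some $p\in(0,1)$, so that the scheme with this $p$ achieves the rate $R(\mathcal X)$. Moreover $R(\mathcal X)$ is an achievable rate for block codes with feedback: for every $\varepsilon>0$ and every sufficiently large $T$ there is a feedback code of block length $T$ with at least $2^{T(R(\mathcal X)-\varepsilon)}$ messages and error probability at most $\varepsilon$ for every message and every initial state. For $|\mathcal X|=3$, $R(\mathcal X)=\max_{p\in[0,1]}2\,\dfrac{H_2(p)+1-p}{p+3}$. -/

import Mathlib

open MeasureTheory

namespace Ising

/-! ### The Ising channel with noiseless feedback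

The state at time `t` is the previous input, and the output equals the input or the state, each
with probability `1/2`, according to a fresh fair coin.  Times are numbered from `0`; output
histories are lists in chronological order. -/

/-- The law of an i.i.d. sequence of fair coins. -/
noncomputable def coinLaw : Measure (ℕ → Bool) :=
  Measure.infinitePi fun _ => (PMF.uniformOfFintype Bool).toMeasure

/-- The channel output for input `x` and state `s`, when the coin shows `b`. -/
def channelOut {X : Type*} (b : Bool) (x s : X) : X := if b then x else s

/-- The outputs and the current channel state after `t` channel uses, for a feedback encoder `enc`
(past outputs ↦ next input), initial state `s₀` and coin sequence `ω`. -/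
def run {X : Type*} (enc : List X → X) (s₀ : X) (ω : ℕ → Bool) : ℕ → List X × X
  | 0 => ([], s₀)
  | t + 1 =>
    let ys := (run enc s₀ ω t).1
    let s := (run enc s₀ ω t).2
    (ys ++ [channelOut (ω t) (enc ys) s], enc ys)

/-- The outputs during the first `t` channel uses. -/
def outputs {X : Type*} (enc : List X → X) (s₀ : X) (ω : ℕ → Bool) (t : ℕ) : List X :=
  (run enc s₀ ω t).1

/-! ### Feedback codes -/

/-- A variable-length feedback code with message set `M`.  The next input depends on the message
and the past outputs.  From the outputs received so far the decoder either announces a message,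
which ends the transmission, or asks for a further channel use (`none`). -/
structure VarCode (M X : Type*) where
  encode : M → List X → X
  decide : List X → Option M

/-- The transmission of `m` ends after exactly `t` channel uses, with announced message `m'`. -/
def VarCode.StopsWith {M X : Type*} (C : VarCode M X) (s₀ : X) (m : M) (ω : ℕ → Bool)
    (t : ℕ) (m' : M) : Prop :=
  C.decide (outputs (C.encode m) s₀ ω t) = some m' ∧
    ∀ k < t, C.decide (outputs (C.encode m) s₀ ω k) = none

/-- The number of channel uses (infinite if the decoder never announces a message). -/
noncomputable def VarCode.time {M X : Type*} (C : VarCode M X) (s₀ : X) (m : M)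
    (ω : ℕ → Bool) : ℕ∞ :=
  sInf {k : ℕ∞ | ∃ t : ℕ, k = t ∧ C.decide (outputs (C.encode m) s₀ ω t) ≠ none}

/-- The expected number of channel uses for the message `m`. -/
noncomputable def VarCode.expectedTime {M X : Type*} (C : VarCode M X) (s₀ : X) (m : M) : ℝ :=
  (∫⁻ ω, (C.time s₀ m ω : ENNReal) ∂coinLaw).toReal

/-- Zero error, within at most `T` channel uses: for every initial state, message and behaviour of
the channel, the transmission ends after at most `T` uses and the message is decoded correctly. -/
def VarCode.ZeroErrorWithin {M X : Type*} (C : VarCode M X) (T : ℕ) : Prop :=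
  ∀ (s₀ : X) (m : M) (ω : ℕ → Bool), ∃ t ≤ T, C.StopsWith s₀ m ω t m

/-- `R` (in bits per channel use) is an achievable rate of the Ising channel with feedback, for
codes of fixed block length: for every `ε > 0` and all large block lengths `T` there is a feedback
code with at least `2 ^ (T (R - ε))` messages whose error probability is at most `ε`, for every
message and every initial state (which neither encoder nor decoder knows). -/
def IsAchievable (X : Type*) (R : ℝ) : Prop :=
  ∀ ε > 0, ∀ᶠ T : ℕ in Filter.atTop,
    ∃ (M : ℕ) (enc : Fin M → List X → X) (dec : List X → Fin M),
      (2 : ℝ) ^ ((T : ℝ) * (R - ε)) ≤ (M : ℝ) ∧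
      ∀ (s₀ : X) (m : Fin M),
        (coinLaw {ω | dec (outputs (enc m) s₀ ω T) ≠ m}).toReal ≤ ε

/-! ### The coding scheme -/

section Scheme

variable {X : Type*} [DecidableEq X]

/-- The encoder after the first symbol: `u` is the symbol completed last, the second argument lists
the symbols still to be sent, the third the outputs received since `u` was completed.
A symbol `v ≠ u` is sent once if the output equals `v`, and twice otherwise; a symbol `v = u` is
sent twice.  (After the last symbol the transmission is over and the value is irrelevant.) -/
def encodeRest : X → List X → List X → X
  | u, [], _ => u
  | _, v :: _, [] => v
  | u, v :: vs, y :: ys =>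
    if v ≠ u ∧ y = v then encodeRest v vs ys
    else
      match ys with
      | [] => v
      | _ :: ys' => encodeRest v vs ys'

/-- The encoder for the symbol stream `ν`: the first symbol is always sent twice. -/
def schemeEncode {N : ℕ} (ν : Fin (N + 1) → X) : List X → X
  | [] => ν 0
  | [_] => ν 0
  | _ :: _ :: ys => encodeRest (ν 0) (List.ofFn (Fin.tail ν)) ys

/-- The decoder after the first symbol: `u` is the symbol decoded last.  An output `y ≠ u` is the
next symbol; after an output `y = u` the following output is the next symbol. -/
def decodeRest : X → List X → List X
  | _, [] => []
  | u, [y] => if y ≠ u then [y] else []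
  | u, y :: y' :: ys => if y ≠ u then y :: decodeRest y (y' :: ys) else y' :: decodeRest y' ys

/-- The symbols decoded from the outputs received so far. -/
def schemeDecode : List X → List X
  | _ :: y :: ys => y :: decodeRest y ys
  | _ => []

open Classical in
/-- The scheme used with a map `φ` from messages to symbol streams of length `N + 1`: the
transmission ends as soon as the decoded symbols form the stream of a message. -/
noncomputable def schemeCode {M : Type*} {N : ℕ} (φ : M → Fin (N + 1) → X) : VarCode M X where
  encode m := schemeEncode (φ m)
  decide ys :=
    if h : ∃ m, List.ofFn (φ m) = schemeDecode ys then some h.choose else none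

variable [Fintype X]

/-- Transition probabilities of the symbol stream: repeat the last symbol with probability `p`,
otherwise pick one of the other symbols uniformly. -/
noncomputable def transition (p : ℝ) (u v : X) : ℝ :=
  if v = u then p else (1 - p) / ((Fintype.card X : ℝ) - 1)

/-- The law of the first `N + 1` symbols of the stationary Markov stream. -/
noncomputable def markovLaw (p : ℝ) (N : ℕ) (ν : Fin (N + 1) → X) : ℝ :=
  (1 / (Fintype.card X : ℝ)) * ∏ i : Fin N, transition p (ν i.castSucc) (ν i.succ)

/-- The law of the symbol stream `φ m` of a uniformly distributed message `m`. -/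
noncomputable def streamLaw {M : Type*} [Fintype M] {N : ℕ} (φ : M → Fin (N + 1) → X)
    (ν : Fin (N + 1) → X) : ℝ :=
  (Fintype.card {m // φ m = ν} : ℝ) / (Fintype.card M : ℝ)

end Scheme

/-! ### Entropies (in bits) and rates -/

/-- Shannon entropy of a probability mass function. -/
noncomputable def entropy {A : Type*} [Fintype A] (P : A → ℝ) : ℝ :=
  -∑ a, P a * Real.logb 2 (P a)

/-- Relative entropy `D(P ‖ Q)` (for `Q` without zeros). -/
noncomputable def relEntropy {A : Type*} [Fintype A] (P Q : A → ℝ) : ℝ :=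
  ∑ a, P a * Real.logb 2 (P a / Q a)

/-- Binary entropy. -/
noncomputable def H₂ (p : ℝ) : ℝ := -p * Real.logb 2 p - (1 - p) * Real.logb 2 (1 - p)

/-- The entropy rate of the symbol stream. -/
noncomputable def symbolEntropy (X : Type*) [Fintype X] (p : ℝ) : ℝ :=
  H₂ p + (1 - p) * Real.logb 2 ((Fintype.card X : ℝ) - 1)

/-- The expected number of channel uses per symbol. -/
noncomputable def symbolTime (p : ℝ) : ℝ := 2 * p + 1.5 * (1 - p)

/-- The rate of the scheme with parameter `p`. -/
noncomputable def schemeRate (X : Type*) [Fintype X] (p : ℝ) : ℝ :=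
  2 * (H₂ p + (1 - p) * Real.logb 2 ((Fintype.card X : ℝ) - 1)) / (p + 3)

end Ising

/-!
Every symbol costs two channel uses, except that a symbol differing from its predecessor costs only
one with probability `1/2`; the decoder notices this by itself, because only a change of symbol can
produce an output different from the symbol decoded last.  Hence the transmission time of a stream
has mean and variance depending only on its number of changes.

In the Markov stream of length `N + 1` the number of changes is binomial, so its most likely value
has probability at least `1 / (N + 1)`.  The streams with that many changes are equally likely, and
there are therefore `2 ^ (N h + o(N))` of them, where `h` is the entropy rate.  Mapping the messages
injectively to these streams gives the codes; stopped at a fixed time slightly above the mean, they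
are block codes by Chebyshev's inequality.
-/

namespace Ising

/-! ### Running a feedback encoder -/

/-- The sequence `ω` without its first `k` terms. -/
def shift {α : Type*} (k : ℕ) (ω : ℕ → α) : ℕ → α := fun i => ω (i + k)

section Channel

variable {X : Type*}

@[simp]
theorem channelOut_self (b : Bool) (x : X) : channelOut b x x = x := by
  simp [channelOut]

variable (enc : List X → X) (s₀ : X) (ω : ℕ → Bool)

theorem run_succ_eq_cons (t : ℕ) :
    run enc s₀ ω (t + 1) =
      let y := channelOut (ω 0) (enc []) s₀
      let r := run (fun ys => enc (y :: ys)) (enc []) (shift 1 ω) t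
      (y :: r.1, r.2) := by
  induction t with
  | zero => rfl
  | succ t ih =>
    rw [run, ih]
    rfl

theorem outputs_succ_eq_cons (t : ℕ) :
    outputs enc s₀ ω (t + 1) = channelOut (ω 0) (enc []) s₀ ::
      outputs (fun ys => enc (channelOut (ω 0) (enc []) s₀ :: ys)) (enc []) (shift 1 ω) t :=
  congrArg Prod.fst (run_succ_eq_cons enc s₀ ω t)

theorem length_outputs (t : ℕ) : (outputs enc s₀ ω t).length = t := by
  induction t with
  | zero => rfl
  | succ t ih => simpa [outputs, run] using ih

theorem outputs_prefix_outputs {k t : ℕ} (h : k ≤ t) :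
    outputs enc s₀ ω k <+: outputs enc s₀ ω t := by
  induction t, h using Nat.le_induction with
  | base => exact List.prefix_rfl
  | succ t _ ih => exact ih.trans (List.prefix_append _ _)

theorem take_outputs {k t : ℕ} (h : k ≤ t) :
    (outputs enc s₀ ω t).take k = outputs enc s₀ ω k := by
  simpa only [length_outputs] using
    (List.prefix_iff_eq_take.1 (outputs_prefix_outputs enc s₀ ω h)).symm

end Channel

theorem VarCode.StopsWith.time_eq {M X : Type*} {C : VarCode M X} {s₀ : X} {m m' : M}
    {ω : ℕ → Bool} {t : ℕ} (h : C.StopsWith s₀ m ω t m') : C.time s₀ m ω = t := by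
  apply le_antisymm
  · exact sInf_le ⟨t, rfl, by simp [h.1]⟩
  · refine le_sInf ?_
    rintro _ ⟨k, rfl, hk⟩
    by_contra hlt
    exact hk (h.2 k (by simpa using hlt))

/-! ### Zero error -/

section Scheme

variable {X : Type*} [DecidableEq X]

/-- The number of channel uses spent on the symbols `vs` when `u` was completed last and the
remaining coins are `ω`: one for a symbol that differs from its predecessor and meets the coin
`true`, two for any other symbol. -/
def restTime : X → List X → (ℕ → Bool) → ℕ
  | _, [], _ => 0
  | u, v :: vs, ω =>
    if v ≠ u ∧ ω 0 = true then restTime v vs (shift 1 ω) + 1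
    else restTime v vs (shift 2 ω) + 2

theorem restTime_le (u : X) (vs : List X) (ω : ℕ → Bool) :
    restTime u vs ω ≤ 2 * vs.length := by
  induction vs generalizing u ω with
  | nil => simp [restTime]
  | cons v vs ih =>
    rw [restTime, List.length_cons]
    have h₁ := ih v (shift 1 ω)
    have h₂ := ih v (shift 2 ω)
    split_ifs <;> omega

theorem decodeRest_cons_of_ne {u v : X} (h : v ≠ u) (ys : List X) :
    decodeRest u (v :: ys) = v :: decodeRest v ys := by
  cases ys <;> simp [decodeRest, h]

theorem decodeRest_cons_cons_self (u v : X) (ys : List X) :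
    decodeRest u (u :: v :: ys) = v :: decodeRest v ys := by
  simp [decodeRest]

theorem outputs_encodeRest_of_immediate {u v : X} (vs : List X) {ω : ℕ → Bool}
    (h : v ≠ u ∧ ω 0 = true) (t : ℕ) :
    outputs (encodeRest u (v :: vs)) u ω (t + 1) =
      v :: outputs (encodeRest v vs) v (shift 1 ω) t := by
  have first_input : encodeRest u (v :: vs) [] = v := rfl
  have first_output : channelOut (ω 0) v u = v := by simp [channelOut, h.2]
  have encoder_after : (fun ys => encodeRest u (v :: vs) (v :: ys)) = encodeRest v vs := by
    funext ys; simp [encodeRest, h.1]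
  rw [outputs_succ_eq_cons]
  simp only [first_input, first_output, encoder_after]

-- The second output is `v` whatever the coin: input and state are both `v`.
theorem outputs_encodeRest_of_not_immediate {u v : X} (vs : List X) {ω : ℕ → Bool}
    (h : ¬(v ≠ u ∧ ω 0 = true)) (t : ℕ) :
    outputs (encodeRest u (v :: vs)) u ω (t + 2) =
      u :: v :: outputs (encodeRest v vs) v (shift 2 ω) t := by
  have first_input : encodeRest u (v :: vs) [] = v := rfl
  have first_output : channelOut (ω 0) v u = u := by
    by_cases hv : v = u
    · simp [hv]
    · simp [channelOut, show ω 0 = false by simpa [hv] using h]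
  have not_received : ¬(v ≠ u ∧ u = v) := fun hu => hu.1 hu.2.symm
  have second_input : encodeRest u (v :: vs) [u] = v := by
    simp only [encodeRest, if_neg not_received]
  have encoder_after : (fun ys => encodeRest u (v :: vs) (u :: v :: ys)) = encodeRest v vs := by
    funext ys; simp only [encodeRest, if_neg not_received]
  rw [outputs_succ_eq_cons, outputs_succ_eq_cons]
  simp only [first_input, first_output, second_input, channelOut_self, encoder_after]
  rfl

theorem outputs_encodeRest_one_of_not_immediate {u v : X} (vs : List X) {ω : ℕ → Bool}
    (h : ¬(v ≠ u ∧ ω 0 = true)) :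
    outputs (encodeRest u (v :: vs)) u ω 1 = [u] := by
  rw [← take_outputs _ _ _ (show 1 ≤ 0 + 2 by simp), outputs_encodeRest_of_not_immediate vs h]
  rfl

theorem decodeRest_outputs_restTime (u : X) (vs : List X) (ω : ℕ → Bool) :
    decodeRest u (outputs (encodeRest u vs) u ω (restTime u vs ω)) = vs := by
  induction vs generalizing u ω with
  | nil => simp [restTime, outputs, run, decodeRest]
  | cons v vs ih =>
    by_cases h : v ≠ u ∧ ω 0 = true
    · rw [restTime, if_pos h, outputs_encodeRest_of_immediate vs h, decodeRest_cons_of_ne h.1, ih]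
    · rw [restTime, if_neg h, outputs_encodeRest_of_not_immediate vs h, decodeRest_cons_cons_self,
        ih]

theorem length_decodeRest_lt_of_lt_restTime (u : X) (vs : List X) (ω : ℕ → Bool) {k : ℕ}
    (hk : k < restTime u vs ω) :
    (decodeRest u (outputs (encodeRest u vs) u ω k)).length < vs.length := by
  induction vs generalizing u ω k with
  | nil => simp [restTime] at hk
  | cons v vs ih =>
    by_cases h : v ≠ u ∧ ω 0 = true
    · rw [restTime, if_pos h] at hk
      cases k with
      | zero => simp [outputs, run, decodeRest]
      | succ k =>
        rw [outputs_encodeRest_of_immediate vs h, decodeRest_cons_of_ne h.1]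
        simpa using ih v _ (Nat.lt_of_succ_lt_succ hk)
    · rw [restTime, if_neg h] at hk
      match k, hk with
      | 0, _ => simp [outputs, run, decodeRest]
      | 1, _ => simp [outputs_encodeRest_one_of_not_immediate vs h, decodeRest]
      | k + 2, hk =>
        rw [outputs_encodeRest_of_not_immediate vs h, decodeRest_cons_cons_self]
        simpa using ih v _ (show k < _ by omega)

variable {N : ℕ}

/-- The number of channel uses of the scheme for the stream `ν` and the coins `ω`. -/
def streamTime (ν : Fin (N + 1) → X) (ω : ℕ → Bool) : ℕ :=
  restTime (ν 0) (List.ofFn (Fin.tail ν)) (shift 2 ω) + 2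

theorem streamTime_le (ν : Fin (N + 1) → X) (ω : ℕ → Bool) : streamTime ν ω ≤ 2 * (N + 1) := by
  have := restTime_le (ν 0) (List.ofFn (Fin.tail ν)) (shift 2 ω)
  rw [List.length_ofFn] at this
  rw [streamTime]
  omega

theorem outputs_schemeEncode (ν : Fin (N + 1) → X) (s₀ : X) (ω : ℕ → Bool) (t : ℕ) :
    outputs (schemeEncode ν) s₀ ω (t + 2) = channelOut (ω 0) (ν 0) s₀ :: ν 0 ::
      outputs (encodeRest (ν 0) (List.ofFn (Fin.tail ν))) (ν 0) (shift 2 ω) t := by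
  rw [outputs_succ_eq_cons, outputs_succ_eq_cons]
  simp only [schemeEncode, channelOut_self]
  rfl

theorem schemeDecode_outputs_streamTime (ν : Fin (N + 1) → X) (s₀ : X) (ω : ℕ → Bool) :
    schemeDecode (outputs (schemeEncode ν) s₀ ω (streamTime ν ω)) = List.ofFn ν := by
  rw [streamTime, outputs_schemeEncode, schemeDecode, decodeRest_outputs_restTime, List.ofFn_succ]
  rfl

theorem length_schemeDecode_lt_of_lt_streamTime (ν : Fin (N + 1) → X) (s₀ : X) (ω : ℕ → Bool)
    {k : ℕ} (hk : k < streamTime ν ω) :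
    (schemeDecode (outputs (schemeEncode ν) s₀ ω k)).length < N + 1 := by
  match k, hk with
  | 0, _ => simp [outputs, run, schemeDecode]
  | 1, _ => simp [outputs, run, schemeDecode]
  | k + 2, hk =>
    have := length_decodeRest_lt_of_lt_restTime (ν 0) (List.ofFn (Fin.tail ν)) (shift 2 ω)
      (Nat.lt_of_add_lt_add_right hk)
    rw [List.length_ofFn] at this
    rw [outputs_schemeEncode, schemeDecode, List.length_cons]
    omega

variable {M : Type*} {φ : M → Fin (N + 1) → X}

theorem schemeCode_decide_eq_none {ys : List X} (h : (schemeDecode ys).length < N + 1) :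
    (schemeCode φ).decide ys = none := by
  refine dif_neg ?_
  rintro ⟨m, hm⟩
  rw [← hm, List.length_ofFn] at h
  exact lt_irrefl _ h

theorem schemeCode_decide_eq_some (hφ : Function.Injective φ) {ys : List X} {m : M}
    (h : schemeDecode ys = List.ofFn (φ m)) : (schemeCode φ).decide ys = some m := by
  have hex : ∃ m, List.ofFn (φ m) = schemeDecode ys := ⟨m, h.symm⟩
  refine (dif_pos hex).trans (congrArg some (hφ (List.ofFn_injective ?_)))
  exact hex.choose_spec.trans h

theorem schemeCode_stopsWith (hφ : Function.Injective φ) (s₀ : X) (m : M) (ω : ℕ → Bool) :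
    (schemeCode φ).StopsWith s₀ m ω (streamTime (φ m) ω) m :=
  ⟨schemeCode_decide_eq_some hφ (schemeDecode_outputs_streamTime (φ m) s₀ ω), fun _ hk =>
    schemeCode_decide_eq_none (length_schemeDecode_lt_of_lt_streamTime (φ m) s₀ ω hk)⟩

theorem schemeCode_zeroErrorWithin (hφ : Function.Injective φ) :
    (schemeCode φ).ZeroErrorWithin (2 * (N + 1)) :=
  fun s₀ m ω => ⟨_, streamTime_le (φ m) ω, schemeCode_stopsWith hφ s₀ m ω⟩

theorem schemeCode_time (hφ : Function.Injective φ) (s₀ : X) (m : M) (ω : ℕ → Bool) :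
    (schemeCode φ).time s₀ m ω = streamTime (φ m) ω :=
  (schemeCode_stopsWith hφ s₀ m ω).time_eq

end Scheme

/-! ### Sequences of independent coins -/

section Coins

variable {α : Type*}

/-- The sequence that starts with `a` and continues with `x`. -/
def consSeq (a : α) (x : ℕ → α) : ℕ → α
  | 0 => a
  | n + 1 => x n

theorem consSeq_preimage_pi_range (n : ℕ) (t : ℕ → Set α) :
    (fun q : α × (ℕ → α) => consSeq q.1 q.2) ⁻¹' (Finset.range (n + 1) : Set ℕ).pi t =
      t 0 ×ˢ (Finset.range n : Set ℕ).pi fun i => t (i + 1) := by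
  ext ⟨a, x⟩
  simp only [Set.mem_preimage, Set.mem_pi, Set.mem_prod, Finset.mem_coe, Finset.mem_range]
  refine ⟨fun h => ⟨h 0 n.succ_pos, fun i hi => h (i + 1) (Nat.succ_lt_succ hi)⟩, ?_⟩
  rintro ⟨h₀, h⟩ (_ | i) hi
  · exact h₀
  · exact h i (Nat.lt_of_succ_lt_succ hi)

variable [MeasurableSpace α]

theorem measurable_consSeq : Measurable fun q : α × (ℕ → α) => consSeq q.1 q.2 := by
  refine measurable_pi_iff.2 ?_
  rintro (_ | n)
  · exact measurable_fst
  · exact (measurable_pi_apply n).comp measurable_snd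

theorem measurable_shift (k : ℕ) : Measurable (shift k : (ℕ → α) → ℕ → α) :=
  measurable_pi_iff.2 fun i => measurable_pi_apply (i + k)

variable (μ : Measure α) [IsProbabilityMeasure μ]

theorem measurePreserving_consSeq :
    MeasurePreserving (fun q : α × (ℕ → α) => consSeq q.1 q.2)
      (μ.prod (Measure.infinitePi fun _ => μ)) (Measure.infinitePi fun _ => μ) := by
  classical
  refine ⟨measurable_consSeq, Measure.eq_infinitePi _ fun s t ht => ?_⟩
  obtain ⟨n, hn⟩ : ∃ n, s ⊆ Finset.range (n + 1) :=
    ⟨s.sup id, fun i hi => Finset.mem_range_succ_iff.2 (Finset.le_sup (f := id) hi)⟩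
  let t' i := if i ∈ s then t i else Set.univ
  have ht' i : MeasurableSet (t' i) := by
    by_cases hi : i ∈ s
    · simpa only [t', if_pos hi] using ht i
    · simp only [t', if_neg hi, MeasurableSet.univ]
  have pi_eq : (s : Set ℕ).pi t = (Finset.range (n + 1) : Set ℕ).pi t' := by
    ext x
    simp only [Set.mem_pi, Finset.mem_coe, t']
    refine ⟨fun h i _ => ?_, fun h i hi => by simpa only [if_pos hi] using h i (hn hi)⟩
    split_ifs with hi
    exacts [h i hi, Set.mem_univ _]
  have prod_eq : ∏ i ∈ s, μ (t i) = ∏ i ∈ Finset.range (n + 1), μ (t' i) := by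
    rw [← Finset.prod_subset hn fun i _ hi => by simp only [t', if_neg hi, measure_univ]]
    exact Finset.prod_congr rfl fun i hi => by simp only [t', if_pos hi]
  rw [pi_eq, prod_eq, Measure.map_apply measurable_consSeq
    (.pi (Finset.countable_toSet _) fun i _ => ht' i), consSeq_preimage_pi_range,
    Measure.prod_prod, Measure.infinitePi_pi _ fun i _ => ht' (i + 1), Finset.prod_range_succ',
    mul_comm]

theorem measurePreserving_shift (k : ℕ) :
    MeasurePreserving (shift k) (Measure.infinitePi fun _ : ℕ => μ)
      (Measure.infinitePi fun _ : ℕ => μ) := by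
  induction k with
  | zero => exact .id _
  | succ k ih =>
    have shift_one : MeasurePreserving (shift 1) (Measure.infinitePi fun _ : ℕ => μ)
        (Measure.infinitePi fun _ : ℕ => μ) := by
      refine ⟨measurable_shift 1, ?_⟩
      conv_lhs => rw [← (measurePreserving_consSeq μ).map_eq]
      rw [Measure.map_map (measurable_shift 1) measurable_consSeq]
      exact (measurePreserving_snd (μ := μ)).map_eq
    exact ih.comp shift_one

end Coins

instance : IsProbabilityMeasure coinLaw := by unfold coinLaw; infer_instance

theorem measurePreserving_shift_coinLaw (k : ℕ) :
    MeasurePreserving (shift k) coinLaw coinLaw :=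
  measurePreserving_shift _ k

theorem integral_shift_coinLaw {f : (ℕ → Bool) → ℝ} (hf : Measurable f) (k : ℕ) :
    ∫ ω, f (shift k ω) ∂coinLaw = ∫ ω, f ω ∂coinLaw := by
  rw [← integral_map (measurable_shift k).aemeasurable hf.aestronglyMeasurable,
    (measurePreserving_shift_coinLaw k).map_eq]

theorem integral_coinLaw {f : (ℕ → Bool) → ℝ} (hf : Integrable f coinLaw) :
    ∫ ω, f ω ∂coinLaw =
      (∫ ω, f (consSeq true ω) ∂coinLaw + ∫ ω, f (consSeq false ω) ∂coinLaw) / 2 := by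
  have cons_law : MeasurePreserving (fun q : Bool × (ℕ → Bool) => consSeq q.1 q.2)
      ((PMF.uniformOfFintype Bool).toMeasure.prod coinLaw) coinLaw :=
    measurePreserving_consSeq _
  calc ∫ ω, f ω ∂coinLaw
      = ∫ q, f (consSeq q.1 q.2) ∂(PMF.uniformOfFintype Bool).toMeasure.prod coinLaw := by
        conv_lhs => rw [← cons_law.map_eq]
        exact integral_map measurable_consSeq.aemeasurable
          (cons_law.map_eq.symm ▸ hf.aestronglyMeasurable)
    _ = ∫ b, ∫ ω, f (consSeq b ω) ∂coinLaw ∂(PMF.uniformOfFintype Bool).toMeasure :=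
        integral_prod _ (cons_law.integrable_comp_of_integrable hf)
    _ = _ := by
        rw [PMF.integral_eq_sum]
        simp only [Fintype.sum_bool, PMF.uniformOfFintype_apply, Fintype.card_bool, smul_eq_mul,
          ENNReal.toReal_inv, Nat.cast_ofNat, ENNReal.toReal_ofNat]
        ring

/-! ### Mean and variance of the number of channel uses -/

theorem memLp_comp_of_le {Ω : Type*} [MeasurableSpace Ω] {μ : Measure Ω} [IsFiniteMeasure μ]
    {f : Ω → ℕ} (hf : Measurable f) {n : ℕ} (hn : ∀ ω, f ω ≤ n) (F : ℕ → ℝ) (q : ENNReal) :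
    MemLp (fun ω => F (f ω)) q μ := by
  refine MemLp.of_bound ((measurable_of_countable F).comp hf).aestronglyMeasurable
    (∑ t ∈ Finset.range (n + 1), ‖F t‖) (Filter.Eventually.of_forall fun ω => ?_)
  exact Finset.single_le_sum (f := fun t => ‖F t‖) (fun t _ => norm_nonneg _)
    (Finset.mem_range_succ_iff.2 (hn ω))

section Time

variable {X : Type*} [DecidableEq X]

theorem measurable_restTime (u : X) (vs : List X) : Measurable (restTime u vs) := by
  induction vs generalizing u with
  | nil => exact measurable_const
  | cons v vs ih =>
    have first_coin : MeasurableSet {ω : ℕ → Bool | v ≠ u ∧ ω 0 = true} :=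
      (MeasurableSet.const _).inter (measurableSet_eq_fun (measurable_pi_apply 0) measurable_const)
    exact Measurable.ite first_coin (((ih v).comp (measurable_shift 1)).add_const 1)
      (((ih v).comp (measurable_shift 2)).add_const 2)

theorem measurable_streamTime {N : ℕ} (ν : Fin (N + 1) → X) : Measurable (streamTime ν) :=
  ((measurable_restTime _ _).comp (measurable_shift 2)).add_const 2

theorem integral_comp_restTime_shift (F : ℕ → ℝ) (u : X) (vs : List X) (k : ℕ) :
    ∫ ω, F (restTime u vs (shift k ω)) ∂coinLaw = ∫ ω, F (restTime u vs ω) ∂coinLaw :=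
  integral_shift_coinLaw ((measurable_of_countable F).comp (measurable_restTime u vs)) k

theorem integral_comp_restTime_cons_self (F : ℕ → ℝ) (v : X) (vs : List X) :
    ∫ ω, F (restTime v (v :: vs) ω) ∂coinLaw = ∫ ω, F (restTime v vs ω + 2) ∂coinLaw := by
  have repeated (ω : ℕ → Bool) : restTime v (v :: vs) ω = restTime v vs (shift 2 ω) + 2 :=
    if_neg (by simp)
  simp only [repeated]
  exact integral_comp_restTime_shift (fun t => F (t + 2)) v vs 2

theorem integral_comp_restTime_cons_of_ne (F : ℕ → ℝ) {u v : X} (h : v ≠ u) (vs : List X) :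
    ∫ ω, F (restTime u (v :: vs) ω) ∂coinLaw =
      (∫ ω, F (restTime v vs ω + 1) ∂coinLaw + ∫ ω, F (restTime v vs ω + 2) ∂coinLaw) / 2 := by
  have sent_once (ω : ℕ → Bool) :
      restTime u (v :: vs) (consSeq true ω) = restTime v vs ω + 1 := if_pos ⟨h, rfl⟩
  have sent_twice (ω : ℕ → Bool) :
      restTime u (v :: vs) (consSeq false ω) = restTime v vs (shift 1 ω) + 2 :=
    if_neg (by simp [consSeq])
  rw [integral_coinLaw (memLp_one_iff_integrable.1
    (memLp_comp_of_le (measurable_restTime _ _) (restTime_le _ _) F 1))]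
  simp only [sent_once, sent_twice]
  rw [integral_comp_restTime_shift fun t => F (t + 2)]

/-- The number of changes of symbol in `u :: vs`. -/
def restChanges : X → List X → ℕ
  | _, [] => 0
  | u, v :: vs => restChanges v vs + if v = u then 0 else 1

theorem integral_restTime_add (u : X) (vs : List X) (c : ℝ) :
    ∫ ω, ((restTime u vs ω : ℝ) + c) ∂coinLaw =
      2 * vs.length - restChanges u vs / 2 + c := by
  induction vs generalizing u c with
  | nil => simp [restTime, restChanges]
  | cons v vs ih =>
    rw [restChanges, List.length_cons]
    by_cases h : v = u
    · subst h
      rw [integral_comp_restTime_cons_self fun t => (t : ℝ) + c]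
      simp only [Nat.cast_add, Nat.cast_ofNat, add_assoc, ih, if_true]
      push_cast
      ring
    · rw [integral_comp_restTime_cons_of_ne (fun t => (t : ℝ) + c) h]
      simp only [Nat.cast_add, Nat.cast_ofNat, Nat.cast_one, add_assoc, ih, if_neg h]
      ring

theorem integral_restTime_sub_sq (u : X) (vs : List X) (c : ℝ) :
    ∫ ω, ((restTime u vs ω : ℝ) - c) ^ 2 ∂coinLaw =
      restChanges u vs / 4 + (2 * vs.length - restChanges u vs / 2 - c) ^ 2 := by
  induction vs generalizing u c with
  | nil => simp [restTime, restChanges]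
  | cons v vs ih =>
    rw [restChanges, List.length_cons]
    by_cases h : v = u
    · subst h
      rw [integral_comp_restTime_cons_self fun t => ((t : ℝ) - c) ^ 2]
      simp only [Nat.cast_add, Nat.cast_ofNat, ← sub_sub_eq_add_sub, ih, if_true]
      push_cast
      ring
    · rw [integral_comp_restTime_cons_of_ne (fun t => ((t : ℝ) - c) ^ 2) h]
      simp only [Nat.cast_add, Nat.cast_ofNat, Nat.cast_one, ← sub_sub_eq_add_sub, ih, if_neg h]
      ring

variable {N : ℕ}

/-- The number of changes of symbol in a stream. -/
def streamChanges (ν : Fin (N + 1) → X) : ℕ :=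
  ∑ i : Fin N, if ν i.succ = ν i.castSucc then 0 else 1

theorem restChanges_ofFn_tail (ν : Fin (N + 1) → X) :
    restChanges (ν 0) (List.ofFn (Fin.tail ν)) = streamChanges ν := by
  induction N with
  | zero => simp [restChanges, streamChanges]
  | succ N ih =>
    rw [List.ofFn_succ, restChanges, streamChanges, Fin.sum_univ_succ, add_comm]
    exact congrArg₂ _ rfl (ih (Fin.tail ν))

theorem streamChanges_le (ν : Fin (N + 1) → X) : streamChanges ν ≤ N := by
  calc streamChanges ν ≤ ∑ _i : Fin N, 1 := Finset.sum_le_sum fun i _ => by split_ifs <;> simp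
    _ = N := by simp

/-- The expected number of channel uses for a stream of length `N + 1` with `d` changes. -/
noncomputable def meanTime (N d : ℕ) : ℝ := 2 + 2 * N - d / 2

theorem integral_streamTime (ν : Fin (N + 1) → X) :
    ∫ ω, (streamTime ν ω : ℝ) ∂coinLaw = meanTime N (streamChanges ν) := by
  simp only [streamTime, Nat.cast_add, Nat.cast_ofNat]
  rw [integral_comp_restTime_shift fun t => (t : ℝ) + 2, integral_restTime_add,
    restChanges_ofFn_tail, List.length_ofFn, meanTime]
  ring

theorem variance_streamTime (ν : Fin (N + 1) → X) :
    ProbabilityTheory.variance (fun ω => (streamTime ν ω : ℝ)) coinLaw = streamChanges ν / 4 := by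
  have measurable_time : Measurable fun ω => (streamTime ν ω : ℝ) :=
    (measurable_of_countable _).comp (measurable_streamTime ν)
  rw [ProbabilityTheory.variance_eq_integral measurable_time.aemeasurable, integral_streamTime]
  simp only [streamTime, Nat.cast_add, Nat.cast_ofNat, ← sub_sub_eq_add_sub]
  rw [integral_comp_restTime_shift fun t => ((t : ℝ) - (meanTime N (streamChanges ν) - 2)) ^ 2,
    integral_restTime_sub_sq, restChanges_ofFn_tail, List.length_ofFn, meanTime]
  ring

theorem coinLaw_lt_streamTime_le (ν : Fin (N + 1) → X) {T : ℕ}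
    (hT : meanTime N (streamChanges ν) < T) :
    (coinLaw {ω | T < streamTime ν ω}).toReal ≤
      N / (4 * (T - meanTime N (streamChanges ν)) ^ 2) := by
  have gap_pos : 0 < T - meanTime N (streamChanges ν) := sub_pos.2 hT
  have chebyshev := ProbabilityTheory.meas_ge_le_variance_div_sq (μ := coinLaw)
    (memLp_comp_of_le (measurable_streamTime ν) (streamTime_le ν) (fun t => (t : ℝ)) 2) gap_pos
  rw [variance_streamTime, integral_streamTime] at chebyshev
  have late_subset : {ω | T < streamTime ν ω} ⊆ {ω | T - meanTime N (streamChanges ν) ≤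
      |(streamTime ν ω : ℝ) - meanTime N (streamChanges ν)|} := fun ω hω => by
    have : (T : ℝ) ≤ streamTime ν ω := by exact_mod_cast (Set.mem_ofPred_eq ▸ hω : _ < _).le
    exact (sub_le_sub_right this _).trans (le_abs_self _)
  calc (coinLaw {ω | T < streamTime ν ω}).toReal
      ≤ streamChanges ν / 4 / (T - meanTime N (streamChanges ν)) ^ 2 :=
        ENNReal.toReal_le_of_le_ofReal (by positivity)
          ((measure_mono late_subset).trans chebyshev)
    _ ≤ N / 4 / (T - meanTime N (streamChanges ν)) ^ 2 := by
        gcongr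
        exact_mod_cast streamChanges_le ν
    _ = _ := div_div _ _ _

variable {M : Type*} {φ : M → Fin (N + 1) → X}

theorem schemeCode_expectedTime (hφ : Function.Injective φ) (s₀ : X) (m : M) :
    (schemeCode φ).expectedTime s₀ m = meanTime N (streamChanges (φ m)) := by
  have measurable_time : Measurable fun ω => (streamTime (φ m) ω : ENNReal) :=
    (measurable_of_countable _).comp (measurable_streamTime (φ m))
  rw [VarCode.expectedTime, ← integral_streamTime]
  simp only [schemeCode_time hφ, ENat.toENNReal_coe]
  rw [← integral_toReal measurable_time.aemeasurable
    (Filter.Eventually.of_forall fun ω => ENNReal.natCast_lt_top _)]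
  simp only [ENNReal.toReal_natCast]

end Time

/-! ### Binomial weights -/

section Binomial

variable (N : ℕ)

theorem eval_bernsteinPolynomial (d : ℕ) (q : ℝ) :
    (bernsteinPolynomial ℝ N d).eval q = N.choose d * q ^ d * (1 - q) ^ (N - d) := by
  simp [bernsteinPolynomial]

theorem eval_bernsteinPolynomial_succ_zero (q : ℝ) :
    (bernsteinPolynomial ℝ (N + 1) 0).eval q = (1 - q) * (bernsteinPolynomial ℝ N 0).eval q := by
  simp only [eval_bernsteinPolynomial, Nat.choose_zero_right, Nat.sub_zero]
  ring

theorem eval_bernsteinPolynomial_succ_succ (d : ℕ) (q : ℝ) :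
    (bernsteinPolynomial ℝ (N + 1) (d + 1)).eval q =
      (1 - q) * (bernsteinPolynomial ℝ N (d + 1)).eval q +
        q * (bernsteinPolynomial ℝ N d).eval q := by
  simp only [eval_bernsteinPolynomial, Nat.choose_succ_succ, Nat.succ_eq_add_one,
    Nat.add_sub_add_right]
  rcases lt_or_ge d N with hd | hd
  · rw [show N - d = N - (d + 1) + 1 by omega]
    push_cast
    ring
  · rw [Nat.choose_eq_zero_of_lt (Nat.lt_succ_of_le hd)]
    push_cast
    ring

theorem eval_bernsteinPolynomial_succ_mul (j : ℕ) (q : ℝ) :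
    (bernsteinPolynomial ℝ N (j + 1)).eval q * ((j + 1) * (1 - q)) =
      (bernsteinPolynomial ℝ N j).eval q * ((N - j) * q) := by
  simp only [eval_bernsteinPolynomial]
  rcases lt_or_ge j N with hj | hj
  · have choose_step : (N.choose (j + 1) : ℝ) * (j + 1) = N.choose j * (N - j) := by
      rw [← Nat.cast_sub hj.le]
      exact_mod_cast Nat.choose_succ_right_eq N j
    rw [show N - j = N - (j + 1) + 1 by omega, pow_succ (1 - q)]
    linear_combination (q ^ (j + 1) * (1 - q) ^ (N - (j + 1)) * (1 - q)) * choose_step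
  · rw [Nat.choose_eq_zero_of_lt (Nat.lt_succ_of_le hj)]
    rcases hj.eq_or_lt with rfl | hj
    · simp
    · simp [Nat.choose_eq_zero_of_lt hj]

variable {N} {q : ℝ}

theorem eval_bernsteinPolynomial_nonneg (hq : q ∈ Set.Icc (0 : ℝ) 1) (j : ℕ) :
    0 ≤ (bernsteinPolynomial ℝ N j).eval q := by
  have := hq.1
  have := sub_nonneg.2 hq.2
  rw [eval_bernsteinPolynomial]
  positivity

theorem eval_bernsteinPolynomial_le_succ (hq : q ∈ Set.Ico (0 : ℝ) 1) {j : ℕ}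
    (hj : j + 1 ≤ (N + 1) * q) :
    (bernsteinPolynomial ℝ N j).eval q ≤ (bernsteinPolynomial ℝ N (j + 1)).eval q := by
  have := sub_pos.2 hq.2
  refine le_of_mul_le_mul_right ?_ (show 0 < (j + 1) * (1 - q) by positivity)
  rw [eval_bernsteinPolynomial_succ_mul]
  exact mul_le_mul_of_nonneg_left (by linarith)
    (eval_bernsteinPolynomial_nonneg (Set.Ico_subset_Icc_self hq) j)

theorem eval_bernsteinPolynomial_succ_le (hq : q ∈ Set.Ico (0 : ℝ) 1) {j : ℕ}
    (hj : (N + 1) * q ≤ j + 1) :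
    (bernsteinPolynomial ℝ N (j + 1)).eval q ≤ (bernsteinPolynomial ℝ N j).eval q := by
  have := sub_pos.2 hq.2
  refine le_of_mul_le_mul_right ?_ (show 0 < (j + 1) * (1 - q) by positivity)
  rw [eval_bernsteinPolynomial_succ_mul]
  exact mul_le_mul_of_nonneg_left (by linarith)
    (eval_bernsteinPolynomial_nonneg (Set.Ico_subset_Icc_self hq) j)

theorem eval_bernsteinPolynomial_le_mode (hq : q ∈ Set.Ico (0 : ℝ) 1) (j : ℕ) :
    (bernsteinPolynomial ℝ N j).eval q ≤
      (bernsteinPolynomial ℝ N ⌊(N + 1) * q⌋₊).eval q := by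
  have mean_nonneg : 0 ≤ (N + 1) * q := mul_nonneg (by positivity) hq.1
  rcases le_total j ⌊(N + 1) * q⌋₊ with hj | hj
  · induction hj using Nat.decreasingInduction with
    | self => exact le_rfl
    | of_succ i hi ih =>
      refine (eval_bernsteinPolynomial_le_succ hq ?_).trans ih
      exact_mod_cast (Nat.le_floor_iff mean_nonneg).1 hi
  · induction j, hj using Nat.le_induction with
    | base => exact le_rfl
    | succ i hi ih =>
      refine (eval_bernsteinPolynomial_succ_le hq ?_).trans ih
      exact_mod_cast (Nat.lt_succ_of_le hi |> (Nat.floor_lt mean_nonneg).1).le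

theorem one_le_mul_eval_bernsteinPolynomial_mode (N : ℕ) (hq : q ∈ Set.Ico (0 : ℝ) 1) :
    1 ≤ (N + 1) * (bernsteinPolynomial ℝ N ⌊(N + 1) * q⌋₊).eval q := by
  have sum_eq_one := congrArg (Polynomial.eval q) (bernsteinPolynomial.sum ℝ N)
  rw [Polynomial.eval_finsetSum, Polynomial.eval_one] at sum_eq_one
  calc 1 = ∑ j ∈ Finset.range (N + 1), (bernsteinPolynomial ℝ N j).eval q := sum_eq_one.symm
    _ ≤ ∑ _j ∈ Finset.range (N + 1), (bernsteinPolynomial ℝ N ⌊(N + 1) * q⌋₊).eval q :=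
        Finset.sum_le_sum fun j _ => eval_bernsteinPolynomial_le_mode hq j
    _ = _ := by simp

end Binomial

/-! ### Markov streams -/

section PathLaw

variable {X : Type*}

/-- The law of the first `N + 1` symbols of the Markov chain with initial law `π` and transition
matrix `P`. -/
def pathLaw (π : X → ℝ) (P : X → X → ℝ) {N : ℕ} (ν : Fin (N + 1) → X) : ℝ :=
  π (ν 0) * ∏ i : Fin N, P (ν i.castSucc) (ν i.succ)

theorem pathLaw_snoc (π : X → ℝ) (P : X → X → ℝ) {N : ℕ} (ν : Fin (N + 1) → X) (x : X) :
    pathLaw π P (Fin.snoc (α := fun _ => X) ν x) = pathLaw π P ν * P (ν (Fin.last N)) x := by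
  rw [pathLaw, Fin.prod_univ_castSucc, ← Fin.castSucc_zero]
  simp only [Fin.succ_castSucc, Fin.succ_last, Fin.snoc_castSucc, Fin.snoc_last, pathLaw,
    mul_assoc]

theorem pathLaw_mul_logb_pathLaw (π : X → ℝ) (P : X → X → ℝ) {N : ℕ} (ν : Fin (N + 1) → X) :
    pathLaw π P ν * Real.logb 2 (pathLaw π P ν) =
      pathLaw π P ν * Real.logb 2 (π (ν 0)) +
        pathLaw π P ν * ∑ i : Fin N, Real.logb 2 (P (ν i.castSucc) (ν i.succ)) := by
  by_cases h : pathLaw π P ν = 0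
  · simp only [h, zero_mul, add_zero]
  · have hprod := right_ne_zero_of_mul h
    rw [← mul_add, ← Real.logb_prod _ _ (Finset.prod_ne_zero_iff.1 hprod),
      ← Real.logb_mul (left_ne_zero_of_mul h) hprod, pathLaw]

theorem streamChanges_snoc [DecidableEq X] {N : ℕ} (ν : Fin (N + 1) → X) (x : X) :
    streamChanges (Fin.snoc (α := fun _ => X) ν x) =
      streamChanges ν + if x = ν (Fin.last N) then 0 else 1 := by
  rw [streamChanges, Fin.sum_univ_castSucc]
  simp only [Fin.succ_castSucc, Fin.succ_last, Fin.snoc_castSucc, Fin.snoc_last, streamChanges]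

theorem cast_streamChanges [DecidableEq X] {N : ℕ} (ν : Fin (N + 1) → X) :
    (streamChanges ν : ℝ) = ∑ i : Fin N, if ν i.succ = ν i.castSucc then 0 else 1 := by
  simp [streamChanges]

variable [Fintype X] {π : X → ℝ} {P : X → X → ℝ}

theorem sum_pathLaw_mul_eq_sum_snoc {N : ℕ} (F : (Fin (N + 2) → X) → ℝ) :
    ∑ ν, pathLaw π P ν * F ν =
      ∑ ν : Fin (N + 1) → X, pathLaw π P ν *
        ∑ x, P (ν (Fin.last N)) x * F (Fin.snoc (α := fun _ => X) ν x) := by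
  rw [← (Fin.snocEquiv fun _ : Fin (N + 2) => X).sum_comp, Fintype.sum_prod_type,
    Finset.sum_comm]
  refine Finset.sum_congr rfl fun ν _ => ?_
  rw [Finset.mul_sum]
  refine Finset.sum_congr rfl fun x _ => ?_
  rw [← mul_assoc, ← pathLaw_snoc]
  rfl

theorem sum_pathLaw_mul_apply_zero (hP : ∀ u, ∑ v, P u v = 1) (f : X → ℝ) (N : ℕ) :
    ∑ ν : Fin (N + 1) → X, pathLaw π P ν * f (ν 0) = ∑ x, π x * f x := by
  induction N with
  | zero =>
    rw [← (Equiv.funUnique (Fin 1) X).symm.sum_comp]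
    simp [pathLaw]
  | succ N ih =>
    rw [sum_pathLaw_mul_eq_sum_snoc, ← ih]
    simp only [← Fin.castSucc_zero, Fin.snoc_castSucc, ← Finset.sum_mul, hP, one_mul]

theorem sum_pathLaw (hP : ∀ u, ∑ v, P u v = 1) (N : ℕ) :
    ∑ ν : Fin (N + 1) → X, pathLaw π P ν = ∑ x, π x := by
  simpa only [mul_one] using sum_pathLaw_mul_apply_zero hP (fun _ => 1) N

theorem sum_pathLaw_mul_sum (hπ : ∑ x, π x = 1) (hP : ∀ u, ∑ v, P u v = 1) {g : X → X → ℝ} {c : ℝ}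
    (hg : ∀ u, ∑ v, P u v * g u v = c) (N : ℕ) :
    ∑ ν : Fin (N + 1) → X, pathLaw π P ν * ∑ i : Fin N, g (ν i.castSucc) (ν i.succ) = N * c := by
  induction N with
  | zero => simp
  | succ N ih =>
    rw [sum_pathLaw_mul_eq_sum_snoc]
    simp only [Fin.sum_univ_castSucc, Fin.succ_castSucc, Fin.succ_last, Fin.snoc_castSucc,
      Fin.snoc_last, mul_add, Finset.sum_add_distrib, ← Finset.sum_mul, hP, hg, one_mul, ih]
    rw [sum_pathLaw hP, hπ]
    push_cast
    ring

theorem entropy_pathLaw (hπ : ∑ x, π x = 1) (hP : ∀ u, ∑ v, P u v = 1) {h : ℝ}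
    (hh : ∀ u, entropy (P u) = h) (N : ℕ) :
    entropy (pathLaw π P (N := N)) = entropy π + N * h := by
  have steps := sum_pathLaw_mul_sum hπ hP (g := fun u v => Real.logb 2 (P u v)) (c := -h)
    (fun u => by rw [← hh u, entropy, neg_neg]) N
  simp only [entropy, pathLaw_mul_logb_pathLaw, Finset.sum_add_distrib, steps]
  rw [sum_pathLaw_mul_apply_zero hP fun x => Real.logb 2 (π x)]
  ring

variable [DecidableEq X]

theorem sum_mul_ite_eq {Q : X → ℝ} (hQ : ∑ v, Q v = 1) (u : X) (a b : ℝ) :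
    ∑ v, Q v * (if v = u then a else b) = Q u * a + (1 - Q u) * b := by
  have split (v : X) : Q v * (if v = u then a else b) =
      Q v * b + if v = u then Q v * (a - b) else 0 := by
    split_ifs <;> ring
  simp only [split, Finset.sum_add_distrib, ← Finset.sum_mul, hQ, Finset.sum_ite_eq',
    Finset.mem_univ, if_true]
  ring

theorem sum_pathLaw_streamChanges_eq {p : ℝ} (hπ : ∑ x, π x = 1) (hP : ∀ u, ∑ v, P u v = 1)
    (hp : ∀ u, P u u = p) (N d : ℕ) :
    ∑ ν : Fin (N + 1) → X, pathLaw π P ν * (if streamChanges ν = d then 1 else 0) =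
      (bernsteinPolynomial ℝ N d).eval (1 - p) := by
  induction N generalizing d with
  | zero =>
    cases d with
    | zero => simpa [streamChanges, eval_bernsteinPolynomial] using (sum_pathLaw hP 0).trans hπ
    | succ d => simp [streamChanges, eval_bernsteinPolynomial]
  | succ N ih =>
    have last_step (ν : Fin (N + 1) → X) :
        ∑ x, P (ν (Fin.last N)) x *
            (if streamChanges (Fin.snoc (α := fun _ => X) ν x) = d then 1 else 0) =
          p * (if streamChanges ν = d then 1 else 0) +
            (1 - p) * (if streamChanges ν + 1 = d then 1 else 0) := by
      rw [← hp (ν (Fin.last N)), ← sum_mul_ite_eq (hP _)]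
      refine Finset.sum_congr rfl fun x _ => ?_
      rw [streamChanges_snoc]
      by_cases hx : x = ν (Fin.last N) <;> simp only [hx, if_true, if_false, add_zero]
    rw [sum_pathLaw_mul_eq_sum_snoc]
    simp only [last_step, mul_add, mul_left_comm (pathLaw π P _), Finset.sum_add_distrib,
      ← Finset.mul_sum, ih]
    cases d with
    | zero => simp [eval_bernsteinPolynomial_succ_zero]
    | succ d => simp only [Nat.add_right_cancel_iff, ih, eval_bernsteinPolynomial_succ_succ,
        sub_sub_cancel]

end PathLaw

section Markov

variable {X : Type*} [Fintype X]

variable (X) in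
theorem card_sub_one_pos [Nontrivial X] : 0 < (Fintype.card X : ℝ) - 1 :=
  sub_pos.2 (Nat.one_lt_cast.2 Fintype.one_lt_card)

variable (X) in
theorem sum_one_div_card [Nonempty X] : ∑ _x : X, 1 / (Fintype.card X : ℝ) = 1 := by
  simp

variable [DecidableEq X]

theorem markovLaw_eq_pathLaw (p : ℝ) (N : ℕ) :
    markovLaw (X := X) p N = pathLaw (fun _ => 1 / (Fintype.card X : ℝ)) (transition p) :=
  rfl

variable [Nontrivial X]

theorem sum_transition (p : ℝ) (u : X) : ∑ v, transition p u v = 1 := by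
  have others (v : X) (hv : v ∈ Finset.univ.erase u) :
      transition p u v = (1 - p) / ((Fintype.card X : ℝ) - 1) :=
    if_neg (Finset.ne_of_mem_erase hv)
  rw [← Finset.add_sum_erase _ _ (Finset.mem_univ u), Finset.sum_congr rfl others,
    Finset.sum_const, Finset.card_erase_of_mem (Finset.mem_univ u), Finset.card_univ, nsmul_eq_mul,
    Nat.cast_sub Fintype.card_pos, Nat.cast_one, mul_div_cancel₀ _ (card_sub_one_pos X).ne',
    transition, if_pos rfl, add_sub_cancel]

theorem sum_transition_mul_ite (p : ℝ) (u : X) (a b : ℝ) :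
    ∑ v, transition p u v * (if v = u then a else b) = p * a + (1 - p) * b := by
  simpa only [transition, if_true] using sum_mul_ite_eq (sum_transition p u) u a b

theorem sum_markovLaw (p : ℝ) (N : ℕ) : ∑ ν : Fin (N + 1) → X, markovLaw p N ν = 1 :=
  (sum_pathLaw (sum_transition p) N).trans (sum_one_div_card X)

theorem entropy_transition (p : ℝ) (u : X) : entropy (transition p u) = symbolEntropy X p := by
  have value (v : X) : Real.logb 2 (transition p u v) =
      if v = u then Real.logb 2 p else Real.logb 2 ((1 - p) / ((Fintype.card X : ℝ) - 1)) :=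
    apply_ite _ _ _ _
  simp only [entropy, value, sum_transition_mul_ite, symbolEntropy, H₂]
  by_cases hp : 1 - p = 0
  · simp [hp]
  · rw [Real.logb_div hp (card_sub_one_pos X).ne']
    ring

theorem entropy_markovLaw (p : ℝ) (N : ℕ) :
    entropy (markovLaw (X := X) p N) =
      Real.logb 2 (Fintype.card X) + N * symbolEntropy X p := by
  rw [markovLaw_eq_pathLaw, entropy_pathLaw (sum_one_div_card X) (sum_transition p)
    (entropy_transition p), entropy, ← Finset.sum_mul, sum_one_div_card, one_mul, one_div,
    Real.logb_inv, neg_neg]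

theorem sum_markovLaw_mul_streamChanges (p : ℝ) (N : ℕ) :
    ∑ ν : Fin (N + 1) → X, markovLaw p N ν * streamChanges ν = N * (1 - p) := by
  simp only [cast_streamChanges]
  exact sum_pathLaw_mul_sum (sum_one_div_card X) (sum_transition p)
    (g := fun u v => if v = u then 0 else 1)
    (fun u => by rw [sum_transition_mul_ite, mul_zero, zero_add, mul_one]) N

theorem sum_markovLaw_mul_expectedTime (p : ℝ) (N : ℕ) (s₀ : X) :
    ∑ ν : Fin (N + 1) → X, markovLaw p N ν *
      (schemeCode (fun ν : Fin (N + 1) → X => ν)).expectedTime s₀ ν = 2 + N * symbolTime p := by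
  simp only [schemeCode_expectedTime (φ := fun ν : Fin (N + 1) → X => ν) Function.injective_id,
    meanTime, mul_sub, Finset.sum_sub_distrib, ← Finset.sum_mul, sum_markovLaw, ← mul_div_assoc,
    ← Finset.sum_div, sum_markovLaw_mul_streamChanges, symbolTime]
  ring

theorem sum_markovLaw_streamChanges_eq (p : ℝ) (N d : ℕ) :
    ∑ ν : Fin (N + 1) → X, markovLaw p N ν * (if streamChanges ν = d then 1 else 0) =
      (bernsteinPolynomial ℝ N d).eval (1 - p) :=
  sum_pathLaw_streamChanges_eq (sum_one_div_card X) (sum_transition p) (fun _ => if_pos rfl) N d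

theorem transition_pos {p : ℝ} (hp : p ∈ Set.Ioo (0 : ℝ) 1) (u v : X) : 0 < transition p u v := by
  rw [transition]
  split_ifs
  · exact hp.1
  · exact div_pos (sub_pos.2 hp.2) (card_sub_one_pos X)

theorem markovLaw_pos {p : ℝ} (hp : p ∈ Set.Ioo (0 : ℝ) 1) {N : ℕ} (ν : Fin (N + 1) → X) :
    0 < markovLaw p N ν :=
  mul_pos (by positivity) (Finset.prod_pos fun _ _ => transition_pos hp _ _)

end Markov

/-! ### Asymptotics of the most likely number of changes -/

open Filter Topology

theorem tendsto_natCast_add_one : Tendsto (fun N : ℕ => (N : ℝ) + 1) atTop atTop :=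
  tendsto_atTop_add_const_right _ _ tendsto_natCast_atTop_atTop

theorem tendsto_natCast_div_add_one : Tendsto (fun N : ℕ => (N : ℝ) / (N + 1)) atTop (𝓝 1) :=
  tendsto_natCast_div_add_atTop 1

theorem tendsto_div_of_tendsto_div_div {ι : Type*} {l : Filter ι} {a b c : ι → ℝ} {α β : ℝ}
    (hc : ∀ i, c i ≠ 0) (hβ : β ≠ 0) (ha : Tendsto (fun i => a i / c i) l (𝓝 α))
    (hb : Tendsto (fun i => b i / c i) l (𝓝 β)) :
    Tendsto (fun i => a i / b i) l (𝓝 (α / β)) :=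
  (ha.div hb hβ).congr fun i => div_div_div_cancel_right₀ (hc i) _ _

theorem tendsto_logb_add_one_div :
    Tendsto (fun N : ℕ => Real.logb 2 (N + 1) / ((N : ℝ) + 1)) atTop (𝓝 0) := by
  have log_div := (Real.isLittleO_log_id_atTop.tendsto_div_nhds_zero.comp
    tendsto_natCast_add_one).div_const (Real.log 2)
  rw [zero_div] at log_div
  exact log_div.congr fun N => div_right_comm _ _ _

theorem H₂_eq_binEntropy_div (p : ℝ) : H₂ p = Real.binEntropy p / Real.log 2 := by
  simp only [H₂, Real.binEntropy, Real.logb, Real.log_inv]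
  ring

theorem H₂_pos {p : ℝ} (hp : p ∈ Set.Ioo (0 : ℝ) 1) : 0 < H₂ p := by
  rw [H₂_eq_binEntropy_div]
  exact div_pos (Real.binEntropy_pos hp.1 hp.2) (Real.log_pos one_lt_two)

theorem symbolTime_pos {p : ℝ} (hp : 0 ≤ p) : 0 < symbolTime p := by
  rw [symbolTime]
  linarith

/-- The most likely number of changes in the Markov stream of length `N + 1`: the mode of the
binomial distribution with `N` trials and success probability `1 - p`. -/
noncomputable def modeChanges (p : ℝ) (N : ℕ) : ℕ := ⌊((N : ℝ) + 1) * (1 - p)⌋₊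

theorem tendsto_modeChanges_div {p : ℝ} (hp : p ≤ 1) :
    Tendsto (fun N => (modeChanges p N : ℝ) / ((N : ℝ) + 1)) atTop (𝓝 (1 - p)) := by
  simp only [modeChanges, mul_comm _ (1 - p)]
  exact (tendsto_nat_floor_mul_div_atTop (sub_nonneg.2 hp)).comp tendsto_natCast_add_one

theorem tendsto_meanTime_div {p : ℝ} (hp : p ≤ 1) :
    Tendsto (fun N => meanTime N (modeChanges p N) / ((N : ℝ) + 1)) atTop (𝓝 (symbolTime p)) := by
  have limit_eq : 2 - (1 - p) / 2 = symbolTime p := by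
    rw [symbolTime]
    ring
  rw [← limit_eq]
  refine (((tendsto_modeChanges_div hp).div_const 2).const_sub 2).congr fun N => ?_
  rw [meanTime]
  field_simp
  ring

section Rates

variable {X : Type*} [Fintype X]

theorem schemeRate_eq_div {p : ℝ} (hp : 0 ≤ p) :
    schemeRate X p = symbolEntropy X p / symbolTime p := by
  rw [schemeRate, ← symbolEntropy,
    div_eq_div_iff (by linarith) (symbolTime_pos hp).ne', symbolTime]
  ring

theorem symbolEntropy_pos [Nontrivial X] {p : ℝ} (hp : p ∈ Set.Ioo (0 : ℝ) 1) :
    0 < symbolEntropy X p := by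
  have two_le_card : (2 : ℝ) ≤ Fintype.card X := by exact_mod_cast Fintype.one_lt_card (α := X)
  exact add_pos_of_pos_of_nonneg (H₂_pos hp)
    (mul_nonneg (sub_nonneg.2 hp.2.le) (Real.logb_nonneg one_lt_two (by linarith)))

/-- Minus the binary logarithm of the Markov probability of a stream of length `N + 1` with `d`
changes. -/
noncomputable def surprisal (X : Type*) [Fintype X] (p : ℝ) (N d : ℕ) : ℝ :=
  Real.logb 2 (Fintype.card X) - N * Real.logb 2 p -
    d * (Real.logb 2 ((1 - p) / ((Fintype.card X : ℝ) - 1)) - Real.logb 2 p)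

theorem logb_markovLaw [DecidableEq X] [Nontrivial X] {p : ℝ} (hp : p ∈ Set.Ioo (0 : ℝ) 1) {N : ℕ}
    (ν : Fin (N + 1) → X) :
    Real.logb 2 (markovLaw p N ν) = -surprisal X p N (streamChanges ν) := by
  have logb_transition (i : Fin N) : Real.logb 2 (transition p (ν i.castSucc) (ν i.succ)) =
      Real.logb 2 p + (if ν i.succ = ν i.castSucc then 0 else 1) *
        (Real.logb 2 ((1 - p) / ((Fintype.card X : ℝ) - 1)) - Real.logb 2 p) := by
    rw [transition]
    split_ifs <;> ring
  rw [markovLaw, Real.logb_mul (by positivity)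
    (Finset.prod_pos fun _ _ => transition_pos hp _ _).ne', one_div, Real.logb_inv,
    Real.logb_prod _ _ fun i _ => (transition_pos hp _ _).ne',
    Finset.sum_congr rfl fun i _ => logb_transition i, Finset.sum_add_distrib, ← Finset.sum_mul,
    ← cast_streamChanges, surprisal, Finset.sum_const, Finset.card_univ, Fintype.card_fin,
    nsmul_eq_mul]
  ring

theorem tendsto_surprisal_div [Nontrivial X] {p : ℝ} (hp : p < 1) :
    Tendsto (fun N => surprisal X p N (modeChanges p N) / ((N : ℝ) + 1)) atTop
      (𝓝 (symbolEntropy X p)) := by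
  have limit_eq : 0 - 1 * Real.logb 2 p - (1 - p) *
      (Real.logb 2 ((1 - p) / ((Fintype.card X : ℝ) - 1)) - Real.logb 2 p) =
      symbolEntropy X p := by
    rw [symbolEntropy, H₂, Real.logb_div (sub_pos.2 hp).ne' (card_sub_one_pos X).ne']
    ring
  rw [← limit_eq]
  have const_div := tendsto_const_nhds (x := Real.logb 2 (Fintype.card X)).div_atTop
    tendsto_natCast_add_one
  refine ((const_div.sub (tendsto_natCast_div_add_one.mul_const _)).sub
    ((tendsto_modeChanges_div hp.le).mul_const _)).congr fun N => ?_
  rw [surprisal]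
  ring

end Rates

/-! ### First passage of a sequence of linear growth -/

theorem tendsto_atTop_of_tendsto_comp {ι : Type*} {l : Filter ι} {f : ℕ → ℝ} {L : ι → ℕ}
    (h : Tendsto (fun i => f (L i)) l atTop) : Tendsto L l atTop := by
  refine tendsto_atTop.2 fun B => ?_
  obtain ⟨C, hC⟩ := ((Finset.range B).image f).exists_le
  filter_upwards [h.eventually_gt_atTop C] with i hi
  by_contra! hlt
  exact hi.not_ge (hC _ (Finset.mem_image_of_mem f (Finset.mem_range.2 hlt)))

theorem tendsto_pred_div_add_one {f : ℕ → ℝ} {h : ℝ}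
    (hf : Tendsto (fun N : ℕ => f N / ((N : ℝ) + 1)) atTop (𝓝 h)) :
    Tendsto (fun N : ℕ => f (N - 1) / ((N : ℝ) + 1)) atTop (𝓝 h) := by
  rw [← mul_one h]
  refine ((hf.comp (tendsto_sub_atTop_nat 1)).mul tendsto_natCast_div_add_one).congr' ?_
  filter_upwards [eventually_gt_atTop 0] with N hN
  rw [Function.comp_apply, Nat.cast_pred hN, sub_add_cancel,
    div_mul_div_cancel₀ (Nat.cast_ne_zero.2 hN.ne')]

theorem exists_firstPassage {f : ℕ → ℝ} {h : ℝ} (hh : 0 < h)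
    (hf : Tendsto (fun N : ℕ => f N / ((N : ℝ) + 1)) atTop (𝓝 h)) :
    ∃ L : ℕ → ℕ, Tendsto L atTop atTop ∧ (∀ n : ℕ, (n : ℝ) ≤ f (L n)) ∧
      Tendsto (fun n : ℕ => (n : ℝ) / ((L n : ℝ) + 1)) atTop (𝓝 h) := by
  have f_atTop : Tendsto f atTop atTop :=
    (hf.pos_mul_atTop hh tendsto_natCast_add_one).congr fun N =>
      div_mul_cancel₀ _ N.cast_add_one_ne_zero
  have reached (n : ℕ) : ∃ N, (n : ℝ) ≤ f N := (f_atTop.eventually_ge_atTop _).exists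
  classical
  let L (n : ℕ) : ℕ := Nat.find (reached n)
  have le_f (n : ℕ) : (n : ℝ) ≤ f (L n) := Nat.find_spec (reached n)
  have L_atTop : Tendsto L atTop atTop :=
    tendsto_atTop_of_tendsto_comp (tendsto_atTop_mono le_f tendsto_natCast_atTop_atTop)
  have f_pred_lt (n : ℕ) (hn : 1 ≤ L n) : f (L n - 1) < n :=
    not_le.1 (Nat.find_min (reached n) (Nat.sub_one_lt_of_lt hn))
  refine ⟨L, L_atTop, le_f, tendsto_of_tendsto_of_tendsto_of_le_of_le'
    ((tendsto_pred_div_add_one hf).comp L_atTop) (hf.comp L_atTop) ?_ ?_⟩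
  · filter_upwards [L_atTop.eventually_ge_atTop 1] with n hn
    exact div_le_div_of_nonneg_right (f_pred_lt n hn).le (by positivity)
  · exact Eventually.of_forall fun n => div_le_div_of_nonneg_right (le_f n) (by positivity)

/-! ### Streams with the most likely number of changes -/

section TypeClass

/-- The streams of length `N + 1` with the most likely number of changes, a type class in the sense
of the method of types: they all have the same Markov probability. -/
abbrev TypicalStream (X : Type*) [DecidableEq X] (p : ℝ) (N : ℕ) : Type _ :=
  {ν : Fin (N + 1) → X // streamChanges ν = modeChanges p N}

variable {X : Type*} [Fintype X] [DecidableEq X] [Nontrivial X] {p : ℝ}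

theorem card_typicalStream_mul (hp : p ∈ Set.Ioo (0 : ℝ) 1) (N : ℕ) :
    (Fintype.card (TypicalStream X p N) : ℝ) * 2 ^ (-surprisal X p N (modeChanges p N)) =
      ∑ ν : Fin (N + 1) → X,
        markovLaw p N ν * (if streamChanges ν = modeChanges p N then 1 else 0) := by
  simp only [mul_ite, mul_one, mul_zero]
  rw [← Finset.sum_filter, Fintype.card_subtype, ← nsmul_eq_mul, ← Finset.sum_const]
  refine Finset.sum_congr rfl fun ν hν => ?_
  rw [← (Finset.mem_filter.1 hν).2, ← logb_markovLaw hp,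
    Real.rpow_logb two_pos (by norm_num) (markovLaw_pos hp ν)]

theorem card_typicalStream_mul_le_one (hp : p ∈ Set.Ioo (0 : ℝ) 1) (N : ℕ) :
    (Fintype.card (TypicalStream X p N) : ℝ) * 2 ^ (-surprisal X p N (modeChanges p N)) ≤ 1 := by
  rw [card_typicalStream_mul hp]
  refine (Finset.sum_le_sum fun ν _ => ?_).trans (sum_markovLaw p N).le
  refine mul_le_of_le_one_right (markovLaw_pos hp ν).le ?_
  split_ifs <;> norm_num

theorem one_le_mul_card_typicalStream_mul (hp : p ∈ Set.Ioo (0 : ℝ) 1) (N : ℕ) :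
    1 ≤ (N + 1 : ℝ) * ((Fintype.card (TypicalStream X p N) : ℝ) *
      2 ^ (-surprisal X p N (modeChanges p N))) := by
  rw [card_typicalStream_mul hp, sum_markovLaw_streamChanges_eq]
  exact one_le_mul_eval_bernsteinPolynomial_mode N ⟨sub_nonneg.2 hp.2.le, sub_lt_self 1 hp.1⟩

theorem card_typicalStream_pos (hp : p ∈ Set.Ioo (0 : ℝ) 1) (N : ℕ) :
    0 < Fintype.card (TypicalStream X p N) := by
  refine Nat.pos_of_ne_zero fun card_eq_zero => ?_
  have := one_le_mul_card_typicalStream_mul (X := X) hp N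
  rw [card_eq_zero] at this
  norm_num at this

theorem logb_card_typicalStream_le (hp : p ∈ Set.Ioo (0 : ℝ) 1) (N : ℕ) :
    Real.logb 2 (Fintype.card (TypicalStream X p N)) ≤ surprisal X p N (modeChanges p N) := by
  have card_pos : (0 : ℝ) < Fintype.card (TypicalStream X p N) :=
    Nat.cast_pos.2 (card_typicalStream_pos hp N)
  have card_le := card_typicalStream_mul_le_one (X := X) hp N
  rw [Real.rpow_neg zero_le_two, mul_inv_le_iff₀ (by positivity), one_mul] at card_le
  exact (Real.logb_le_iff_le_rpow one_lt_two card_pos).2 card_le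

theorem sub_le_logb_card_typicalStream (hp : p ∈ Set.Ioo (0 : ℝ) 1) (N : ℕ) :
    surprisal X p N (modeChanges p N) - Real.logb 2 (N + 1) ≤
      Real.logb 2 (Fintype.card (TypicalStream X p N)) := by
  have card_pos : (0 : ℝ) < Fintype.card (TypicalStream X p N) :=
    Nat.cast_pos.2 (card_typicalStream_pos hp N)
  have logb_le := Real.logb_le_logb_of_le one_lt_two one_pos
    (one_le_mul_card_typicalStream_mul (X := X) hp N)
  rw [Real.logb_one, Real.logb_mul (by positivity) (by positivity),
    Real.logb_mul card_pos.ne' (by positivity), Real.logb_rpow two_pos (by norm_num)] at logb_le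
  linarith

theorem tendsto_logb_card_typicalStream_div (hp : p ∈ Set.Ioo (0 : ℝ) 1) :
    Tendsto (fun N : ℕ => Real.logb 2 (Fintype.card (TypicalStream X p N)) / ((N : ℝ) + 1)) atTop
      (𝓝 (symbolEntropy X p)) := by
  have upper := tendsto_surprisal_div (X := X) hp.2
  have lower := upper.sub tendsto_logb_add_one_div
  rw [sub_zero] at lower
  refine tendsto_of_tendsto_of_tendsto_of_le_of_le lower upper (fun N => ?_) fun N =>
    div_le_div_of_nonneg_right (logb_card_typicalStream_le hp N) (by positivity)
  dsimp only
  rw [← sub_div]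
  exact div_le_div_of_nonneg_right (sub_le_logb_card_typicalStream hp N) (by positivity)

theorem exists_typical_codes (hp : p ∈ Set.Ioo (0 : ℝ) 1) :
    ∃ (N : ℕ → ℕ) (φ : ∀ n : ℕ, (Fin n → Bool) → Fin (N n + 1) → X),
      Tendsto N atTop atTop ∧ (∀ n, Function.Injective (φ n)) ∧
      (∀ n m, streamChanges (φ n m) = modeChanges p (N n)) ∧
      Tendsto (fun n : ℕ => (n : ℝ) / ((N n : ℝ) + 1)) atTop (𝓝 (symbolEntropy X p)) := by
  obtain ⟨N, hN, bits_le, rate⟩ :=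
    exists_firstPassage (symbolEntropy_pos hp) (tendsto_logb_card_typicalStream_div (X := X) hp)
  have card_le (n : ℕ) : 2 ^ n ≤ Fintype.card (TypicalStream X p (N n)) := by
    have := (Real.le_logb_iff_rpow_le one_lt_two
      (Nat.cast_pos.2 (card_typicalStream_pos hp _))).1 (bits_le n)
    rw [Real.rpow_natCast] at this
    exact_mod_cast this
  have embedding (n : ℕ) : Nonempty ((Fin n → Bool) ↪ TypicalStream X p (N n)) :=
    Function.Embedding.nonempty_of_card_le (by simpa using card_le n)
  exact ⟨N, fun n m => (embedding n).some m, hN,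
    fun n => Subtype.val_injective.comp (embedding n).some.injective,
    fun n m => ((embedding n).some m).2, rate⟩

end TypeClass

section TypicalCodes

variable {X : Type*} [DecidableEq X] {M : Type*} [Fintype M] {N : ℕ}
  {φ : M → Fin (N + 1) → X}

theorem sum_expectedTime_div_card [Nonempty M] (hφ : Function.Injective φ) {d : ℕ}
    (hd : ∀ m, streamChanges (φ m) = d) (s₀ : X) :
    (∑ m, (schemeCode φ).expectedTime s₀ m) / Fintype.card M = meanTime N d := by
  simp only [schemeCode_expectedTime hφ, hd, Finset.sum_const, Finset.card_univ, nsmul_eq_mul]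
  rw [mul_div_cancel_left₀ _ (Nat.cast_ne_zero.2 Fintype.card_ne_zero)]

theorem streamLaw_apply (hφ : Function.Injective φ) (m : M) :
    streamLaw φ (φ m) = 1 / Fintype.card M := by
  have card_eq_one : Fintype.card {m' // φ m' = φ m} = 1 :=
    Fintype.card_eq_one_iff.2 ⟨⟨m, rfl⟩, fun m' => Subtype.ext (hφ m'.2)⟩
  rw [streamLaw, card_eq_one, Nat.cast_one]

theorem streamLaw_eq_zero {ν : Fin (N + 1) → X} (hν : ν ∉ Set.range φ) : streamLaw φ ν = 0 := by
  have : IsEmpty {m // φ m = ν} := ⟨fun m => hν ⟨m, m.2⟩⟩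
  rw [streamLaw, Fintype.card_eq_zero, Nat.cast_zero, zero_div]

variable [Fintype X]

theorem relEntropy_streamLaw [Nonempty M] (hφ : Function.Injective φ)
    {Q : (Fin (N + 1) → X) → ℝ} (hQ : ∀ m, Q (φ m) ≠ 0) :
    relEntropy (streamLaw φ) Q =
      (∑ m, -Real.logb 2 (Q (φ m))) / Fintype.card M - Real.logb 2 (Fintype.card M) := by
  have card_ne_zero : (Fintype.card M : ℝ) ≠ 0 := Nat.cast_ne_zero.2 Fintype.card_ne_zero
  calc relEntropy (streamLaw φ) Q
      = ∑ m, streamLaw φ (φ m) * Real.logb 2 (streamLaw φ (φ m) / Q (φ m)) :=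
        (Fintype.sum_of_injective φ hφ _ _
          (fun ν hν => by rw [streamLaw_eq_zero hν, zero_mul]) fun _ => rfl).symm
    _ = ∑ m, (-Real.logb 2 (Q (φ m)) / Fintype.card M -
          Real.logb 2 (Fintype.card M) / Fintype.card M) := by
        refine Finset.sum_congr rfl fun m _ => ?_
        rw [streamLaw_apply hφ, Real.logb_div (one_div_ne_zero card_ne_zero) (hQ m), one_div,
          Real.logb_inv]
        ring
    _ = _ := by
        rw [Finset.sum_sub_distrib, ← Finset.sum_div, Finset.sum_const, Finset.card_univ,
          nsmul_eq_mul, mul_div_cancel₀ _ card_ne_zero]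

theorem relEntropy_streamLaw_markovLaw [Nontrivial X] [Nonempty M] {p : ℝ}
    (hp : p ∈ Set.Ioo (0 : ℝ) 1) (hφ : Function.Injective φ) {d : ℕ}
    (hd : ∀ m, streamChanges (φ m) = d) :
    relEntropy (streamLaw φ) (markovLaw p N) =
      surprisal X p N d - Real.logb 2 (Fintype.card M) := by
  rw [relEntropy_streamLaw hφ fun m => (markovLaw_pos hp (φ m)).ne']
  simp only [logb_markovLaw hp, hd, neg_neg, Finset.sum_const, Finset.card_univ, nsmul_eq_mul]
  rw [mul_div_cancel_left₀ _ (Nat.cast_ne_zero.2 Fintype.card_ne_zero)]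

end TypicalCodes

section BitCodes

variable {X : Type*} [DecidableEq X] {p : ℝ} {N : ℕ → ℕ}
  {φ : ∀ n : ℕ, (Fin n → Bool) → Fin (N n + 1) → X}

theorem tendsto_sum_expectedTime_div (hp : p ≤ 1)
    (hN : Tendsto N atTop atTop) (hφ : ∀ n, Function.Injective (φ n))
    (hd : ∀ n m, streamChanges (φ n m) = modeChanges p (N n)) (s₀ : X) :
    Tendsto (fun n => ((∑ m, (schemeCode (φ n)).expectedTime s₀ m) / (2 : ℝ) ^ n) /
      ((N n : ℝ) + 1)) atTop (𝓝 (symbolTime p)) := by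
  refine ((tendsto_meanTime_div hp).comp hN).congr fun n => ?_
  have card_bits : (Fintype.card (Fin n → Bool) : ℝ) = 2 ^ n := by simp
  rw [Function.comp_apply, ← card_bits, sum_expectedTime_div_card (hφ n) (hd n)]

theorem tendsto_relEntropy_div [Fintype X] [Nontrivial X] (hp : p ∈ Set.Ioo (0 : ℝ) 1)
    (hN : Tendsto N atTop atTop) (hφ : ∀ n, Function.Injective (φ n))
    (hd : ∀ n m, streamChanges (φ n m) = modeChanges p (N n))
    (rate : Tendsto (fun n : ℕ => (n : ℝ) / ((N n : ℝ) + 1)) atTop (𝓝 (symbolEntropy X p))) :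
    Tendsto (fun n => relEntropy (streamLaw (φ n)) (markovLaw p (N n)) / ((N n : ℝ) + 1)) atTop
      (𝓝 0) := by
  rw [← sub_self (symbolEntropy X p)]
  refine (((tendsto_surprisal_div hp.2).comp hN).sub rate).congr fun n => ?_
  have logb_card : Real.logb 2 (Fintype.card (Fin n → Bool)) = n := by
    simp [Real.logb_pow]
  rw [relEntropy_streamLaw_markovLaw hp (hφ n) (hd n), logb_card, sub_div, Function.comp_apply]

end BitCodes

/-! ### Block codes -/

theorem tendsto_comp_floor_mul_div {f : ℕ → ℝ} {a c : ℝ} (hc : 0 < c)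
    (hf : Tendsto (fun N : ℕ => f N / ((N : ℝ) + 1)) atTop (𝓝 a)) :
    Tendsto (fun T : ℕ => f ⌊c * T⌋₊ / T) atTop (𝓝 (a * c)) := by
  have floor_atTop : Tendsto (fun T : ℕ => ⌊c * (T : ℝ)⌋₊) atTop atTop :=
    tendsto_nat_floor_atTop.comp (tendsto_natCast_atTop_atTop.const_mul_atTop hc)
  have floor_add_one_div : Tendsto (fun T : ℕ => ((⌊c * (T : ℝ)⌋₊ : ℝ) + 1) / T) atTop (𝓝 c) := by
    have limit := ((tendsto_nat_floor_mul_div_atTop hc.le).comp tendsto_natCast_atTop_atTop).add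
      (tendsto_const_div_atTop_nhds_zero_nat (1 : ℝ))
    rw [add_zero] at limit
    exact limit.congr fun T => (add_div _ _ _).symm
  exact ((hf.comp floor_atTop).mul floor_add_one_div).congr fun T =>
    div_mul_div_cancel₀ (Nat.cast_add_one_ne_zero _)

theorem tendsto_div_sub_sq {a m : ℕ → ℝ} {α β : ℝ} (hβ : β ≠ 1)
    (ha : Tendsto (fun T : ℕ => a T / T) atTop (𝓝 α))
    (hm : Tendsto (fun T : ℕ => m T / T) atTop (𝓝 β)) :
    Tendsto (fun T : ℕ => a T / (T - m T) ^ 2) atTop (𝓝 0) := by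
  have limit := (ha.mul (tendsto_const_div_atTop_nhds_zero_nat 1)).div ((hm.const_sub 1).pow 2)
    (pow_ne_zero 2 (sub_ne_zero.2 hβ.symm))
  rw [mul_zero, zero_div] at limit
  refine limit.congr' ?_
  filter_upwards [eventually_ne_atTop 0] with T hT
  have hT : (T : ℝ) ≠ 0 := Nat.cast_ne_zero.2 hT
  rw [Pi.div_apply, one_sub_div hT, div_pow, div_mul_div_comm, mul_one, ← sq,
    div_div_div_cancel_right₀ (pow_ne_zero 2 hT)]

/-- The block decoder of a variable-length code: the message announced first while the outputs are
read one by one, `none` if no message is announced. -/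
def VarCode.blockDecode {M X : Type*} (C : VarCode M X) (ys : List X) : Option M :=
  (List.range (ys.length + 1)).findSome? fun k => C.decide (ys.take k)

theorem VarCode.StopsWith.blockDecode_eq {M X : Type*} {C : VarCode M X} {s₀ : X} {m m' : M}
    {ω : ℕ → Bool} {t T : ℕ} (h : C.StopsWith s₀ m ω t m') (htT : t ≤ T) :
    C.blockDecode (outputs (C.encode m) s₀ ω T) = some m' := by
  obtain ⟨r, rfl⟩ := Nat.exists_eq_add_of_le htT
  have range_eq : List.range (t + r + 1) =
      List.range t ++ t :: (List.range r).map (t + 1 + ·) := by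
    rw [add_right_comm, List.range_add, List.range_succ, List.append_assoc, List.singleton_append]
  refine List.findSome?_eq_some_iff.2 ⟨_, t, _, by rw [length_outputs, range_eq], ?_, ?_⟩
  · rw [take_outputs _ _ _ htT]
    exact h.1
  · intro k hk
    rw [take_outputs _ _ _ ((List.mem_range.1 hk).le.trans htT)]
    exact h.2 k (List.mem_range.1 hk)

section BlockCodes

theorem coinLaw_blockDecode_ne_le {X M : Type*} [DecidableEq X] {N T d : ℕ}
    {φ : M → Fin (N + 1) → X} (hφ : Function.Injective φ) (hd : ∀ m, streamChanges (φ m) = d)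
    (hT : meanTime N d < T) (s₀ : X) (m : M) :
    (coinLaw {ω | (schemeCode φ).blockDecode
      (outputs ((schemeCode φ).encode m) s₀ ω T) ≠ some m}).toReal ≤
        N / (4 * (T - meanTime N d) ^ 2) := by
  obtain rfl := hd m
  refine (ENNReal.toReal_mono (measure_ne_top _ _) (measure_mono fun ω error => ?_)).trans
    (coinLaw_lt_streamTime_le (φ m) hT)
  exact lt_of_not_ge fun time_le =>
    error ((schemeCode_stopsWith hφ s₀ m ω).blockDecode_eq time_le)

variable {X : Type*} [Fintype X] [Nontrivial X] {p : ℝ}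

theorem exists_blockCode [DecidableEq X] (hp : p ∈ Set.Ioo (0 : ℝ) 1) {N T : ℕ}
    (hT : meanTime N (modeChanges p N) < T) :
    ∃ (enc : Fin (Fintype.card (TypicalStream X p N)) → List X → X)
      (dec : List X → Fin (Fintype.card (TypicalStream X p N))), ∀ s₀ m,
        (coinLaw {ω | dec (outputs (enc m) s₀ ω T) ≠ m}).toReal ≤
          N / (4 * (T - meanTime N (modeChanges p N)) ^ 2) := by
  let e := (Fintype.equivFin (TypicalStream X p N)).symm
  have injective : Function.Injective fun m => (e m).1 := Subtype.val_injective.comp e.injective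
  let C := schemeCode fun m => (e m).1
  refine ⟨C.encode, fun ys => (C.blockDecode ys).getD ⟨0, card_typicalStream_pos hp N⟩,
    fun s₀ m => ?_⟩
  refine (ENNReal.toReal_mono (measure_ne_top _ _) (measure_mono fun ω error decoded => ?_)).trans
    (coinLaw_blockDecode_ne_le injective (fun m => (e m).2) hT s₀ m)
  exact error (congrArg (Option.getD · _) decoded)

theorem isAchievable_schemeRate (hp : p ∈ Set.Ioo (0 : ℝ) 1) :
    IsAchievable X (schemeRate X p) := by
  classical
  intro ε hε
  have entropy_pos := symbolEntropy_pos (X := X) hp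
  have time_pos := symbolTime_pos hp.1.le
  -- With `c T` symbols in block length `T`, slightly fewer than `T / symbolTime p`, the mean
  -- transmission time stays below `T` by a linear margin.
  obtain ⟨c, hc, c_lt⟩ : ∃ c, max 0 ((schemeRate X p - ε) / symbolEntropy X p) < c ∧
      c < 1 / symbolTime p := by
    refine exists_between (max_lt (by positivity) ?_)
    rw [div_lt_iff₀ entropy_pos, schemeRate_eq_div hp.1.le, one_div_mul_eq_div]
    exact sub_lt_self _ hε
  obtain ⟨c_pos, rate_lt⟩ := max_lt_iff.1 hc
  rw [div_lt_iff₀' entropy_pos] at rate_lt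
  rw [lt_div_iff₀' time_pos] at c_lt
  have bits := tendsto_comp_floor_mul_div c_pos (tendsto_logb_card_typicalStream_div (X := X) hp)
  have mean := tendsto_comp_floor_mul_div c_pos (tendsto_meanTime_div hp.2.le)
  have error := (tendsto_div_sub_sq c_lt.ne
    (tendsto_comp_floor_mul_div c_pos tendsto_natCast_div_add_one) mean).div_const 4
  rw [zero_div] at error
  filter_upwards [eventually_gt_atTop 0, bits.eventually_const_lt rate_lt,
    mean.eventually_lt_const c_lt, error.eventually_lt_const hε] with T hT bits_T mean_T error_T
  have hT : (0 : ℝ) < T := Nat.cast_pos.2 hT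
  rw [lt_div_iff₀' hT] at bits_T
  rw [div_lt_one hT] at mean_T
  rw [div_div, mul_comm _ (4 : ℝ)] at error_T
  obtain ⟨enc, dec, error_le⟩ := exists_blockCode (X := X) hp mean_T
  exact ⟨_, enc, dec, (Real.le_logb_iff_rpow_le one_lt_two
    (Nat.cast_pos.2 (card_typicalStream_pos hp _))).1 bits_T.le,
    fun s₀ m => (error_le s₀ m).trans error_T.le⟩

end BlockCodes

/-! ### The maximal rate -/

section Maximum

theorem continuous_H₂ : Continuous H₂ := by
  rw [funext H₂_eq_binEntropy_div]
  exact Real.binEntropy_continuous.div_const _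

theorem neg_mul_logb_le_H₂ {p : ℝ} (hp : p ∈ Set.Icc (0 : ℝ) 1) : -p * Real.logb 2 p ≤ H₂ p := by
  have logb_nonpos : Real.logb 2 (1 - p) ≤ 0 :=
    Real.logb_nonpos one_lt_two (sub_nonneg.2 hp.2) (sub_le_self 1 hp.1)
  exact le_sub_self_iff _ |>.2 (mul_nonpos_of_nonneg_of_nonpos (sub_nonneg.2 hp.2) logb_nonpos)

variable {X : Type*} [Fintype X]

theorem continuousOn_schemeRate : ContinuousOn (schemeRate X) (Set.Icc 0 1) := by
  have := continuous_H₂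
  unfold schemeRate
  refine ContinuousOn.div (by fun_prop) (by fun_prop) fun p hp => ?_
  linarith [hp.1]

theorem schemeRate_one : schemeRate X 1 = 0 := by
  simp [schemeRate, H₂]

theorem schemeRate_pos [Nontrivial X] {p : ℝ} (hp : p ∈ Set.Ioo (0 : ℝ) 1) :
    0 < schemeRate X p := by
  rw [schemeRate_eq_div hp.1.le]
  exact div_pos (symbolEntropy_pos hp) (symbolTime_pos hp.1.le)

-- The witness `p = 1 / |X| ^ 2` is small enough for `-p * log p` to outweigh both the loss
-- `p * log (|X| - 1)` in the numerator and the growth of the denominator.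
theorem exists_schemeRate_zero_lt [Nontrivial X] :
    ∃ p ∈ Set.Icc (0 : ℝ) 1, schemeRate X 0 < schemeRate X p := by
  have one_lt_card : (1 : ℝ) < Fintype.card X := by exact_mod_cast Fintype.one_lt_card (α := X)
  set k : ℝ := (Fintype.card X : ℝ) with hk
  have hp : 1 / k ^ 2 ∈ Set.Icc (0 : ℝ) 1 :=
    ⟨by positivity, div_le_one_of_le₀ (one_le_pow₀ one_lt_card.le) (by positivity)⟩
  refine ⟨1 / k ^ 2, hp, ?_⟩
  have logb_p : Real.logb 2 (1 / k ^ 2) = -(2 * Real.logb 2 k) := by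
    rw [one_div, Real.logb_inv, Real.logb_pow, Nat.cast_two]
  have entropy_ge := neg_mul_logb_le_H₂ hp
  rw [logb_p] at entropy_ge
  have p_mul_logb_pos : 0 < 1 / k ^ 2 * Real.logb 2 k :=
    mul_pos (by positivity) (Real.logb_pos one_lt_two one_lt_card)
  have p_mul_logb_le : 1 / k ^ 2 * Real.logb 2 (k - 1) ≤ 1 / k ^ 2 * Real.logb 2 k :=
    mul_le_mul_of_nonneg_left (Real.logb_le_logb_of_le one_lt_two (sub_pos.2 one_lt_card)
      (sub_le_self k zero_le_one)) hp.1
  have H₂_zero : H₂ 0 = 0 := by simp [H₂]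
  rw [schemeRate, schemeRate, H₂_zero, ← hk, div_lt_div_iff₀ (by norm_num) (by linarith [hp.1])]
  linarith

theorem exists_isGreatest_schemeRate [Nontrivial X] :
    ∃ p ∈ Set.Ioo (0 : ℝ) 1, IsGreatest (schemeRate X '' Set.Icc 0 1) (schemeRate X p) := by
  obtain ⟨p, hp, hmax⟩ := isCompact_Icc.exists_isMaxOn (Set.nonempty_Icc.2 zero_le_one)
    (continuousOn_schemeRate (X := X))
  have p_ne_zero : p ≠ 0 := by
    rintro rfl
    obtain ⟨q, hq, rate_lt⟩ := exists_schemeRate_zero_lt (X := X)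
    exact (hmax hq).not_gt rate_lt
  have p_ne_one : p ≠ 1 := by
    rintro rfl
    have half : (1 / 2 : ℝ) ∈ Set.Ioo (0 : ℝ) 1 := by norm_num
    exact (hmax (Set.Ioo_subset_Icc_self half)).not_gt
      (schemeRate_one.trans_lt (schemeRate_pos half))
  exact ⟨p, ⟨hp.1.lt_of_ne' p_ne_zero, hp.2.lt_of_ne p_ne_one⟩, Set.mem_image_of_mem _ hp,
    Set.forall_mem_image.2 fun q hq => hmax hq⟩

theorem schemeRate_of_card_eq_three (hX : Fintype.card X = 3) :
    schemeRate X = fun p : ℝ => 2 * (H₂ p + 1 - p) / (p + 3) := by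
  funext p
  have logb_two : Real.logb 2 (((3 : ℕ) : ℝ) - 1) = 1 := by norm_num
  rw [schemeRate, hX, logb_two, mul_one, add_sub_assoc]

end Maximum

end Ising

theorem theorem3 {X : Type*} [Fintype X] [DecidableEq X] (hX : 2 ≤ Fintype.card X) :
    -- every stream of symbols is transmitted without error
    (∀ N : ℕ, (Ising.schemeCode (fun ν : Fin (N + 1) → X => ν)).ZeroErrorWithin (2 * (N + 1))) ∧
    -- entropy and expected transmission length of the Markov symbol stream
    (∀ p ∈ Set.Icc (0 : ℝ) 1, ∀ N : ℕ,
      (∑ ν : Fin (N + 1) → X, Ising.markovLaw p N ν = 1) ∧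
      Ising.entropy (Ising.markovLaw (X := X) p N) =
        Real.logb 2 (Fintype.card X) + N * Ising.symbolEntropy X p ∧
      ∀ s₀ : X,
        ∑ ν : Fin (N + 1) → X, Ising.markovLaw p N ν *
            (Ising.schemeCode (fun ν : Fin (N + 1) → X => ν)).expectedTime s₀ ν =
          2 + N * Ising.symbolTime p) ∧
    -- `n` uniform bits are mapped to a stream with the Markov statistics; the resulting
    -- zero-error code has rate tending to entropy rate / expected transmission length
    (∀ p ∈ Set.Ioo (0 : ℝ) 1,
      Ising.schemeRate X p = Ising.symbolEntropy X p / Ising.symbolTime p ∧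
      ∃ (N : ℕ → ℕ) (φ : ∀ n : ℕ, (Fin n → Bool) → Fin (N n + 1) → X),
        (∀ n, Function.Injective (φ n)) ∧
        (∀ n, (Ising.schemeCode (φ n)).ZeroErrorWithin (2 * (N n + 1))) ∧
        Filter.Tendsto
          (fun n => Ising.relEntropy (Ising.streamLaw (φ n)) (Ising.markovLaw p (N n)) /
            ((N n : ℝ) + 1))
          Filter.atTop (nhds 0) ∧
        Filter.Tendsto (fun n : ℕ => (n : ℝ) / ((N n : ℝ) + 1))
          Filter.atTop (nhds (Ising.symbolEntropy X p)) ∧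
        ∀ s₀ : X,
          Filter.Tendsto
            (fun n => ((∑ m, (Ising.schemeCode (φ n)).expectedTime s₀ m) / (2 : ℝ) ^ n) /
              ((N n : ℝ) + 1))
            Filter.atTop (nhds (Ising.symbolTime p)) ∧
          Filter.Tendsto
            (fun n : ℕ =>
              (n : ℝ) / ((∑ m, (Ising.schemeCode (φ n)).expectedTime s₀ m) / (2 : ℝ) ^ n))
            Filter.atTop (nhds (Ising.schemeRate X p))) ∧
    -- the best parameter, the maximal rate, and its value for a ternary alphabet
    ∃ R : ℝ,
      IsGreatest (Ising.schemeRate X '' Set.Icc 0 1) R ∧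
      (∃ p ∈ Set.Ioo (0 : ℝ) 1, Ising.schemeRate X p = R) ∧
      Ising.IsAchievable X R ∧
      (Fintype.card X = 3 →
        IsGreatest ((fun p : ℝ => 2 * (Ising.H₂ p + 1 - p) / (p + 3)) '' Set.Icc 0 1) R) := by
  have : Nontrivial X := Fintype.one_lt_card_iff_nontrivial.1 hX
  refine ⟨fun N => Ising.schemeCode_zeroErrorWithin Function.injective_id,
    fun p _ N => ⟨Ising.sum_markovLaw p N, Ising.entropy_markovLaw p N,
      Ising.sum_markovLaw_mul_expectedTime p N⟩,
    fun p hp => ⟨Ising.schemeRate_eq_div hp.1.le, ?_⟩, ?_⟩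
  · obtain ⟨N, φ, hN, hφ, hd, bits⟩ := Ising.exists_typical_codes (X := X) hp
    refine ⟨N, φ, hφ, fun n => Ising.schemeCode_zeroErrorWithin (hφ n),
      Ising.tendsto_relEntropy_div hp hN hφ hd bits, bits, fun s₀ => ?_⟩
    have time := Ising.tendsto_sum_expectedTime_div hp.2.le hN hφ hd s₀
    rw [Ising.schemeRate_eq_div hp.1.le]
    exact ⟨time, Ising.tendsto_div_of_tendsto_div_div (fun n => Nat.cast_add_one_ne_zero (N n))
      (Ising.symbolTime_pos hp.1.le).ne' bits time⟩
  · obtain ⟨p, hp, hmax⟩ := Ising.exists_isGreatest_schemeRate (X := X)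
    exact ⟨_, hmax, ⟨p, hp, rfl⟩, Ising.isAchievable_schemeRate hp,
      fun card_eq => Ising.schemeRate_of_card_eq_three card_eq ▸ hmax⟩
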